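/- Let $\mathcal W$ be the class of all measurable (not necessarily symmetric) functions $W:\mathcal S\times\mathcal S\to[0,1]$, where $(\mathcal S,\mathcal F,\mu)$ is an arbitrary probability space (taken in a fixed universe of sets) and $\mathcal S\times\mathcal S$ carries the product $\sigma$-field. For a bounded measurable $U:\mathcal S\times\mathcal S\to\mathbb R$ put $$\|U\|_{\square}=\sup_{S,T}\Bigl|\int_{S\times T}U(x,y)\,d\mu(x)\,d\mu(y)\Bigr|,$$ the supremum being over all measurable $S,T\subseteq\mathcal S$. For $W_1,W_2\in\mathcal W$, defined on $(\mathcal S_1,\mu_1)$ and $(\mathcal S_2,\mu_2)$, put $$\delta_{\square}(W_1,W_2)=\inf_{\varphi_1,\varphi_2}\bigl\|W_1^{\varphi_1}-W_2^{\varphi_2}\bigr\|_{\square},\qquad W^{\varphi}(x,y)=W(\varphi(x),\varphi(y)),$$ the infimum being over all pairs of measure preserving maps $\varphi_1:\mathcal S\to\mathcal S_1$, $\varphi_2:\mathcal S\to\mathcal S_2$ defined on a common probability space $(\mathcal S,\mu)$. A function $W\in\mathcal W$ on $(\mathcal S,\mathcal F,\mu)$ is a poset kernel if there is a (strict) partial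 order $\prec$ on $\mathcal S$ such that $\{(x,y):x\prec y\}$ belongs to the product $\sigma$-field and, for all $x,y,z\in\mathcal S$, $W(x,y)>0$ implies $x\prec y$, and $W(x,y)>0$ and $W(y,z)>0$ imply $W(x,z)=1$. Then $W_1\cong W_2\iff\delta_{\square}(W_1,W_2)=0$ is an equivalence relation on $\mathcal W$, $\delta_\square$ is well defined on the quotient $\overline{\mathcal W}=\mathcal W/{\cong}$, and $(\overline{\mathcal W},\delta_\square)$ is a compact metric space. The subset $\overline{\mathcal W}_{\mathsf P}\subseteq\overline{\mathcal W}$ of all classes of poset kernels is closed in $\overline{\mathcal W}$; hence $(\overline{\mathcal W}_{\mathsf P},\delta_\square)$ is a compact metric space. -/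

import Mathlib

open MeasureTheory Set

universe u

/-- The cut norm of a (bounded measurable) real function `W` on the square of a probability space:
the supremum of `|∫_{S × T} W d(μ × μ)|` over all measurable sets `S`, `T`. -/
noncomputable def cutNorm {Ω : Type u} [MeasurableSpace Ω] (μ : Measure Ω) (W : Ω × Ω → ℝ) : ℝ :=
  sSup {c : ℝ | ∃ S T : Set Ω, MeasurableSet S ∧ MeasurableSet T ∧
    c = |∫ p in S ×ˢ T, W p ∂(μ.prod μ)|}

/-- A not necessarily symmetric measurable `[0,1]`-valued function on the square of an arbitrary
probability space (no regularity of the space is assumed); the square carries the product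
`σ`-field. -/
structure CutFunction : Type (u + 1) where
  /-- the underlying set of the probability space -/
  carrier : Type u
  [measurableSpace : MeasurableSpace carrier]
  /-- the probability measure -/
  μ : Measure carrier
  [isProbabilityMeasure : IsProbabilityMeasure μ]
  /-- the function on the square -/
  W : carrier × carrier → ℝ
  measurable_W : Measurable W
  W_mem : ∀ p, W p ∈ Icc (0 : ℝ) 1

attribute [instance] CutFunction.measurableSpace CutFunction.isProbabilityMeasure

namespace CutFunction

/-- The cut metric: the infimum of `‖W₁^{φ₁} - W₂^{φ₂}‖_cut` over all pairs of measure preserving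
maps `φ₁`, `φ₂` from a common probability space to the two given ones, where
`W^φ (x, y) = W (φ x, φ y)`. -/
noncomputable def cutDist (K₁ K₂ : CutFunction.{u}) : ℝ :=
  sInf {d : ℝ | ∃ (Ω : Type u) (_ : MeasurableSpace Ω) (μ : Measure Ω) (_ : IsProbabilityMeasure μ)
    (φ₁ : Ω → K₁.carrier) (φ₂ : Ω → K₂.carrier),
    MeasurePreserving φ₁ μ K₁.μ ∧ MeasurePreserving φ₂ μ K₂.μ ∧
    d = cutNorm μ (fun p => K₁.W (φ₁ p.1, φ₁ p.2) - K₂.W (φ₂ p.1, φ₂ p.2))}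

/-- Cut-equivalence. -/
def CutEquiv (K₁ K₂ : CutFunction.{u}) : Prop := cutDist K₁ K₂ = 0

/-- `K` is a poset kernel: there is a (strict) partial order `≺` on the underlying probability
space, with measurable graph `{(x, y) : x ≺ y}`, such that `W (x, y) > 0` implies `x ≺ y`, and
`W (x, y) > 0` and `W (y, z) > 0` together imply `W (x, z) = 1`, for all points `x`, `y`, `z`. -/
def IsPosetKernel (K : CutFunction.{u}) : Prop :=
  ∃ r : K.carrier → K.carrier → Prop, IsStrictOrder K.carrier r ∧
    MeasurableSet {p : K.carrier × K.carrier | r p.1 p.2} ∧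
    (∀ x y, 0 < K.W (x, y) → r x y) ∧
    (∀ x y z, 0 < K.W (x, y) → 0 < K.W (y, z) → K.W (x, z) = 1)

end CutFunction

/-- The quotient of the class of all `[0,1]`-valued functions modulo cut-equivalence. -/
def CutSpace : Type (u + 1) := Quot CutFunction.CutEquiv.{u}

namespace CutSpace

/-- The class of a function modulo cut-equivalence. -/
def mk (K : CutFunction.{u}) : CutSpace.{u} := Quot.mk _ K

/-- The set of the classes that contain a poset kernel. -/
def posetKernels : Set CutSpace.{u} := mk '' {K | K.IsPosetKernel}

end CutSpace

/-! Couplings of two cut functions with a common third one are glued over a finite step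
approximation of the latter, which gives the triangle inequality on arbitrary probability spaces
without disintegration. For compactness, weak regularity yields a sequence of step
approximations of each function; the joint laws of their labels live on a fixed compact product of
finite sets, so along an ultrafilter the laws and the step values converge, and the limiting step
functions, being Cauchy in cut norm, have a limit function by weak compactness. Finally, the
density of the triples violating the poset kernel axioms is Lipschitz for the cut metric, so the
functions satisfying these axioms almost everywhere form a closed set. Such a function is made a
poset kernel by discarding the pairs which are not density points of `{W > 0}`, and by setting
`W = 1` at the density points of `{W = 1}`: transitivity then holds everywhere, since
`1 + 1 - 1 = 1`. -/

open Filter ProbabilityTheory Topology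

/-- Measurable `[0, 1]`-valued functions: the weights, and the kernels on a square, of the theory
of the cut norm. -/
structure IsUnitFunction {X : Type*} [MeasurableSpace X] (f : X → ℝ) : Prop where
  measurable : Measurable f
  mem_Icc : ∀ x, f x ∈ Icc (0 : ℝ) 1

namespace IsUnitFunction

variable {X Y : Type*} [MeasurableSpace X] [MeasurableSpace Y] {f g : X → ℝ}

theorem nonneg (hf : IsUnitFunction f) (x : X) : 0 ≤ f x := (hf.mem_Icc x).1

theorem le_one (hf : IsUnitFunction f) (x : X) : f x ≤ 1 := (hf.mem_Icc x).2

theorem norm_le_one (hf : IsUnitFunction f) (x : X) : ‖f x‖ ≤ 1 := by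
  rw [Real.norm_of_nonneg (hf.nonneg x)]
  exact hf.le_one x

theorem comp {φ : Y → X} (hf : IsUnitFunction f) (hφ : Measurable φ) : IsUnitFunction (f ∘ φ) :=
  ⟨hf.measurable.comp hφ, fun y => hf.mem_Icc (φ y)⟩

theorem mul (hf : IsUnitFunction f) (hg : IsUnitFunction g) : IsUnitFunction (f * g) :=
  ⟨hf.measurable.mul hg.measurable, fun x => ⟨mul_nonneg (hf.nonneg x) (hg.nonneg x),
    mul_le_one₀ (hf.le_one x) (hg.nonneg x) (hg.le_one x)⟩⟩

theorem integrable (hf : IsUnitFunction f) (μ : Measure X) [IsFiniteMeasure μ] : Integrable f μ :=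
  .of_mem_Icc 0 1 hf.measurable.aemeasurable (.of_forall hf.mem_Icc)

theorem integrable_mul {μ : Measure X} {h : X → ℝ} (hf : IsUnitFunction f) (hh : Integrable h μ) :
    Integrable (f * h) μ :=
  hh.bdd_mul hf.measurable.aestronglyMeasurable (.of_forall hf.norm_le_one)

end IsUnitFunction

section Weights

variable {X Y : Type*} [MeasurableSpace X] [MeasurableSpace Y] {μ : Measure X} {h : X → ℝ} {c : ℝ}

theorem abs_setIntegral_le_integral_abs (hh : Integrable h μ) (S : Set X) :
    |∫ x in S, h x ∂μ| ≤ ∫ x, |h x| ∂μ :=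
  abs_integral_le_integral_abs.trans
    (setIntegral_le_integral hh.abs (.of_forall fun _ => abs_nonneg _))

theorem integral_mul_le_setIntegral_nonneg {f : X → ℝ} (hf : IsUnitFunction f)
    (hh : Integrable h μ) (hS : MeasurableSet {x | 0 ≤ h x}) :
    ∫ x, f x * h x ∂μ ≤ ∫ x in {x | 0 ≤ h x}, h x ∂μ := by
  rw [← integral_indicator hS]
  refine integral_mono (hf.integrable_mul hh) (hh.indicator hS) fun x => ?_
  by_cases hx : 0 ≤ h x
  · simpa [hx] using mul_le_of_le_one_left hx (hf.le_one x)
  · simpa [hx] using mul_nonpos_of_nonneg_of_nonpos (hf.nonneg x) (not_le.1 hx).le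

/-- Once `h` is replaced by its conditional expectation given `φ`, the best weight is the indicator
of the set where it is nonnegative, which has the form `φ ⁻¹' S`. -/
theorem integral_comp_mul_le_of_setIntegral_preimage_le [IsFiniteMeasure μ] {φ : X → Y}
    (hφ : Measurable φ) {f : Y → ℝ} (hf : IsUnitFunction f) (hh : Integrable h μ)
    (hc : ∀ S, MeasurableSet S → ∫ x in φ ⁻¹' S, h x ∂μ ≤ c) :
    ∫ x, f (φ x) * h x ∂μ ≤ c := by
  have hfφ : IsUnitFunction (f ∘ φ) := hf.comp hφ
  let E : X → ℝ := μ[h | .comap φ inferInstance]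
  have hE : Measurable[.comap φ inferInstance] E := stronglyMeasurable_condExp.measurable
  have hpull : μ[f ∘ φ * h | .comap φ inferInstance] =ᵐ[μ] f ∘ φ * E :=
    condExp_mul_of_stronglyMeasurable_left
      (hf.measurable.comp (comap_measurable φ)).stronglyMeasurable (hfφ.integrable_mul hh) hh
  obtain ⟨S, hS, hSE⟩ := hE measurableSet_Ici
  calc ∫ x, f (φ x) * h x ∂μ = ∫ x, f (φ x) * E x ∂μ := by
        rw [← integral_condExp hφ.comap_le (f := fun x => f (φ x) * h x)]
        exact integral_congr_ae hpull
    _ ≤ ∫ x in {x | 0 ≤ E x}, E x ∂μ :=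
        integral_mul_le_setIntegral_nonneg hfφ integrable_condExp
          (hE.mono hφ.comap_le le_rfl measurableSet_Ici)
    _ = ∫ x in φ ⁻¹' S, E x ∂μ := by rw [hSE]; rfl
    _ = ∫ x in φ ⁻¹' S, h x ∂μ := setIntegral_condExp hφ.comap_le hh ⟨S, hS, rfl⟩
    _ ≤ c := hc S hS

theorem abs_integral_comp_mul_le_of_abs_setIntegral_preimage_le [IsFiniteMeasure μ] {φ : X → Y}
    (hφ : Measurable φ) {f : Y → ℝ} (hf : IsUnitFunction f) (hh : Integrable h μ)
    (hc : ∀ S, MeasurableSet S → |∫ x in φ ⁻¹' S, h x ∂μ| ≤ c) :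
    |∫ x, f (φ x) * h x ∂μ| ≤ c := by
  have hneg : ∫ x, f (φ x) * -h x ∂μ ≤ c :=
    integral_comp_mul_le_of_setIntegral_preimage_le hφ hf hh.neg fun S hS => by
      simpa only [Pi.neg_apply, integral_neg] using (neg_le_abs _).trans (hc S hS)
  simp only [mul_neg, integral_neg] at hneg
  exact abs_le'.2 ⟨integral_comp_mul_le_of_setIntegral_preimage_le hφ hf hh fun S hS =>
    (le_abs_self _).trans (hc S hS), hneg⟩

theorem exists_isUnitFunction_withDensity_eq_of_le {ν : Measure X} [IsFiniteMeasure μ]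
    (h : ν ≤ μ) :
    ∃ f : X → ℝ, IsUnitFunction f ∧ ν = μ.withDensity fun x => ENNReal.ofReal (f x) := by
  have : IsFiniteMeasure ν := isFiniteMeasure_of_le μ h
  refine ⟨fun x => (min (ν.rnDeriv μ x) 1).toReal,
    ⟨((ν.measurable_rnDeriv μ).min measurable_const).ennreal_toReal,
      fun x => ⟨ENNReal.toReal_nonneg, ENNReal.toReal_le_of_le_ofReal zero_le_one (by simp)⟩⟩, ?_⟩
  conv_lhs => rw [← Measure.withDensity_rnDeriv_eq ν μ (Measure.absolutelyContinuous_of_le h)]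
  refine withDensity_congr_ae ?_
  filter_upwards [Measure.rnDeriv_le_one_of_le h] with x hx
  rw [ENNReal.ofReal_toReal (by simp), min_eq_left (by simpa using hx)]

end Weights

section CutNorm

variable {Ω : Type u} [MeasurableSpace Ω] {μ : Measure Ω} {U V W : Ω × Ω → ℝ} {c : ℝ}

theorem cutNorm_le
    (h : ∀ S T, MeasurableSet S → MeasurableSet T → |∫ p in S ×ˢ T, W p ∂(μ.prod μ)| ≤ c) :
    cutNorm μ W ≤ c := by
  refine csSup_le ⟨_, ∅, ∅, .empty, .empty, rfl⟩ ?_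
  rintro _ ⟨S, T, hS, hT, rfl⟩
  exact h S T hS hT

theorem abs_setIntegral_le_cutNorm (hW : Integrable W (μ.prod μ)) {S T : Set Ω}
    (hS : MeasurableSet S) (hT : MeasurableSet T) :
    |∫ p in S ×ˢ T, W p ∂(μ.prod μ)| ≤ cutNorm μ W := by
  refine le_csSup ⟨∫ p, |W p| ∂(μ.prod μ), ?_⟩ ⟨S, T, hS, hT, rfl⟩
  rintro _ ⟨S, T, -, -, rfl⟩
  exact abs_setIntegral_le_integral_abs hW _

theorem cutNorm_nonneg (W : Ω × Ω → ℝ) : 0 ≤ cutNorm μ W := by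
  refine Real.sSup_nonneg ?_
  rintro _ ⟨S, T, -, -, rfl⟩
  exact abs_nonneg _

theorem cutNorm_le_integral_abs (hW : Integrable W (μ.prod μ)) :
    cutNorm μ W ≤ ∫ p, |W p| ∂(μ.prod μ) :=
  cutNorm_le fun _ _ _ _ => abs_setIntegral_le_integral_abs hW _

theorem cutNorm_congr_ae (h : V =ᵐ[μ.prod μ] W) : cutNorm μ V = cutNorm μ W := by
  simp only [cutNorm, integral_congr_ae (ae_restrict_of_ae h)]

theorem cutNorm_add_le (hV : Integrable V (μ.prod μ)) (hW : Integrable W (μ.prod μ)) :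
    cutNorm μ (V + W) ≤ cutNorm μ V + cutNorm μ W := by
  refine cutNorm_le fun S T hS hT => ?_
  rw [integral_add' hV.integrableOn hW.integrableOn]
  exact (abs_add_le _ _).trans (add_le_add (abs_setIntegral_le_cutNorm hV hS hT)
    (abs_setIntegral_le_cutNorm hW hS hT))

theorem cutNorm_neg (W : Ω × Ω → ℝ) : cutNorm μ (-W) = cutNorm μ W := by
  simp only [cutNorm, integral_neg', abs_neg]

theorem cutNorm_sub_comm (V W : Ω × Ω → ℝ) : cutNorm μ (V - W) = cutNorm μ (W - V) := by
  rw [← cutNorm_neg, neg_sub]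

theorem cutNorm_sub_le (hU : Integrable U (μ.prod μ)) (hV : Integrable V (μ.prod μ))
    (hW : Integrable W (μ.prod μ)) :
    cutNorm μ (U - W) ≤ cutNorm μ (U - V) + cutNorm μ (V - W) := by
  rw [← sub_add_sub_cancel U V W]
  exact cutNorm_add_le (hU.sub hV) (hV.sub hW)

variable [IsFiniteMeasure μ]

theorem cutNorm_comp_swap (W : Ω × Ω → ℝ) : cutNorm μ (W ∘ Prod.swap) = cutNorm μ W := by
  simp only [cutNorm, Function.comp_apply, setIntegral_prod_swap]
  congr 1
  ext c
  rw [mem_ofPred_eq, exists_comm]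
  simp only [mem_ofPred_eq, and_left_comm]

theorem abs_integral_mul_mul_le_cutNorm (hW : Integrable W (μ.prod μ)) {f g : Ω → ℝ}
    (hf : IsUnitFunction f) (hg : IsUnitFunction g) :
    |∫ p, f p.1 * (g p.2 * W p) ∂(μ.prod μ)| ≤ cutNorm μ W := by
  have hgW : Integrable (g ∘ Prod.snd * W) (μ.prod μ) :=
    (hg.comp measurable_snd).integrable_mul hW
  refine abs_integral_comp_mul_le_of_abs_setIntegral_preimage_le measurable_fst hf hgW
    fun S hS => abs_integral_comp_mul_le_of_abs_setIntegral_preimage_le measurable_snd hg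
      hW.integrableOn fun T hT => ?_
  rw [Measure.restrict_restrict (measurable_snd hT), inter_comm, ← Set.prod_eq]
  exact abs_setIntegral_le_cutNorm hW hS hT

theorem abs_integral_prod_le_cutNorm (hW : Integrable W (μ.prod μ)) {ν₁ ν₂ : Measure Ω}
    (hν₁ : ν₁ ≤ μ) (hν₂ : ν₂ ≤ μ) : |∫ p, W p ∂(ν₁.prod ν₂)| ≤ cutNorm μ W := by
  obtain ⟨f, hf, rfl⟩ := exists_isUnitFunction_withDensity_eq_of_le hν₁
  obtain ⟨g, hg, rfl⟩ := exists_isUnitFunction_withDensity_eq_of_le hν₂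
  have hfm := hf.measurable
  have hgm := hg.measurable
  rw [prod_withDensity hfm.ennreal_ofReal hgm.ennreal_ofReal,
    integral_withDensity_eq_integral_toReal_smul
    (by fun_prop)
    (.of_forall fun _ => ENNReal.mul_lt_top ENNReal.ofReal_lt_top ENNReal.ofReal_lt_top)]
  simpa only [ENNReal.toReal_mul, ENNReal.toReal_ofReal (hf.nonneg _),
    ENNReal.toReal_ofReal (hg.nonneg _), smul_eq_mul, mul_assoc]
    using abs_integral_mul_mul_le_cutNorm hW hf hg

theorem cutNorm_comp {Ω' : Type*} [MeasurableSpace Ω'] {μ' : Measure Ω'} [IsFiniteMeasure μ']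
    {φ : Ω' → Ω} (hφ : MeasurePreserving φ μ' μ) (hW : Integrable W (μ.prod μ)) :
    cutNorm μ' (W ∘ Prod.map φ φ) = cutNorm μ W := by
  have hφφ : MeasurePreserving (Prod.map φ φ) (μ'.prod μ') (μ.prod μ) := hφ.prod hφ
  refine le_antisymm (cutNorm_le fun S T _ _ => ?_) (cutNorm_le fun S T hS hT => ?_)
  · have hle : ∀ A, (μ'.restrict A).map φ ≤ μ := fun A =>
      (Measure.map_mono Measure.restrict_le_self hφ.measurable).trans_eq hφ.map_eq
    have hmap : ((μ'.prod μ').restrict (S ×ˢ T)).map (Prod.map φ φ) =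
        ((μ'.restrict S).map φ).prod ((μ'.restrict T).map φ) := by
      rw [← Measure.prod_restrict, Measure.map_prod_map _ _ hφ.measurable hφ.measurable]
    rw [show ∫ p in S ×ˢ T, (W ∘ Prod.map φ φ) p ∂(μ'.prod μ') = ∫ p, W p ∂_ from
      (integral_map hφφ.measurable.aemeasurable (hW.1.mono_measure
        (hmap.trans_le (Measure.prod_mono (hle S) (hle T))))).symm, hmap]
    exact abs_integral_prod_le_cutNorm hW (hle S) (hle T)
  · rw [← hφφ.map_eq, setIntegral_map (hS.prod hT) (hφφ.map_eq ▸ hW.1)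
      hφφ.measurable.aemeasurable]
    exact abs_setIntegral_le_cutNorm (hφφ.integrable_comp_of_integrable hW)
      (hφ.measurable hS) (hφ.measurable hT)

end CutNorm

/-- `IsStep n V` says that `V` is constant on the boxes of a measurable partition of `Ω` into at
most `n` classes, namely the fibres of a measurable `f : Ω → Fin n`. Values in `Prop` are allowed,
so that `IsStep n (· ∈ A)` says that the set `A` is a union of boxes of such a partition. -/
def IsStep {Ω β : Type*} [MeasurableSpace Ω] (n : ℕ) (V : Ω × Ω → β) : Prop :=
  ∃ f : Ω → Fin n, Measurable f ∧ ∃ U : Fin n × Fin n → β, V = U ∘ Prod.map f f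

namespace IsStep

variable {Ω β γ δ ι : Type*} [MeasurableSpace Ω] {n m : ℕ} {V : Ω × Ω → β}

theorem of_fintype [Fintype ι] [MeasurableSpace ι] [DiscreteMeasurableSpace ι] {f : Ω → ι}
    (hf : Measurable f) (U : ι × ι → β) : IsStep (Fintype.card ι) (U ∘ Prod.map f f) := by
  let e := Fintype.equivFin ι
  refine ⟨e ∘ f, (Measurable.of_discrete (f := e)).comp hf, U ∘ Prod.map e.symm e.symm, ?_⟩
  simp [Function.comp_assoc, Prod.map_comp_map, ← Function.comp_assoc e.symm]

theorem const (b : β) : IsStep 1 (fun _ : Ω × Ω => b) :=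
  ⟨fun _ => 0, measurable_const, fun _ => b, rfl⟩

theorem map (hV : IsStep n V) (h : β → γ) : IsStep n (h ∘ V) := by
  obtain ⟨f, hf, U, rfl⟩ := hV
  exact ⟨f, hf, h ∘ U, rfl⟩

theorem map₂ {V' : Ω × Ω → γ} (hV : IsStep n V) (hV' : IsStep m V') (h : β → γ → δ) :
    IsStep (n * m) (fun p => h (V p) (V' p)) := by
  obtain ⟨f, hf, U, rfl⟩ := hV
  obtain ⟨g, hg, U', rfl⟩ := hV'
  have hcard : Fintype.card (Fin n × Fin m) = n * m := by simp
  rw [← hcard]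
  exact of_fintype (hf.prodMk hg)
    fun q => h (U (Prod.map Prod.fst Prod.fst q)) (U' (Prod.map Prod.snd Prod.snd q))

theorem measurable [MeasurableSpace β] (hV : IsStep n V) : Measurable V := by
  obtain ⟨f, hf, U, rfl⟩ := hV
  exact Measurable.of_discrete.comp (hf.prodMap hf)

theorem mem_prod {S T : Set Ω} (hS : MeasurableSet S) (hT : MeasurableSet T) :
    IsStep 4 (· ∈ S ×ˢ T) := by
  have hcard : Fintype.card (Prop × Prop) = 4 := by simp
  rw [← hcard]
  exact of_fintype (hS.mem.prodMk hT.mem) fun q => q.1.1 ∧ q.2.2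

end IsStep

section StepSets

variable {Ω : Type*} [MeasurableSpace Ω]

theorem isSetAlgebra_isStep : IsSetAlgebra {A : Set (Ω × Ω) | ∃ n, IsStep n (· ∈ A)} where
  empty_mem := ⟨1, .const False⟩
  compl_mem := fun _ ⟨n, hA⟩ => ⟨n, hA.map Not⟩
  union_mem := fun _ _ ⟨n, hA⟩ ⟨m, hB⟩ => ⟨n * m, hA.map₂ hB Or⟩

theorem measureDense_isStep (P : Measure (Ω × Ω)) [IsFiniteMeasure P] :
    P.MeasureDense {A : Set (Ω × Ω) | ∃ n, IsStep n (· ∈ A)} := by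
  refine .of_generateFrom_isSetAlgebra_finite _ isSetAlgebra_isStep (le_antisymm ?_ ?_)
  · rw [← generateFrom_prod]
    refine MeasurableSpace.generateFrom_mono ?_
    rintro _ ⟨S, hS, T, hT, rfl⟩
    exact ⟨4, .mem_prod hS hT⟩
  · exact MeasurableSpace.generateFrom_le fun A ⟨_, hA⟩ => measurableSet_setOfPred.2 hA.measurable

end StepSets

section Regularity

theorem IsUnitFunction.coe {X : Type*} [MeasurableSpace X] {V : X → unitInterval}
    (hV : Measurable V) : IsUnitFunction fun x => (V x : ℝ) :=
  ⟨measurable_subtype_coe.comp hV, fun x => (V x).2⟩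

theorem IsUnitFunction.memLp_sub {X : Type*} [MeasurableSpace X] {P : Measure X}
    [IsFiniteMeasure P] {f g : X → ℝ} (hf : IsUnitFunction f) (hg : IsUnitFunction g) :
    MemLp (f - g) 2 P :=
  .of_bound (hf.measurable.sub hg.measurable).aestronglyMeasurable 1
    (.of_forall fun x => Real.dist_le_of_mem_Icc_01 (hf.mem_Icc x) (hg.mem_Icc x))

theorem sq_sub_projIcc_le {w : ℝ} (hw : w ∈ Icc (0 : ℝ) 1) (v : ℝ) :
    (w - projIcc 0 1 zero_le_one v) ^ 2 ≤ (w - v) ^ 2 := by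
  have h := abs_projIcc_sub_projIcc (c := w) (d := v) (zero_le_one (α := ℝ))
  rw [projIcc_of_mem _ hw] at h
  exact sq_le_sq.2 h

/-- Subtracting from `D` its component along the indicator of `A`, with too small a coefficient
when `P A < 1`, still lowers the energy by the square of that coefficient. -/
theorem integral_sq_sub_indicator_le {X : Type*} [MeasurableSpace X] {P : Measure X}
    [IsProbabilityMeasure P] {D : X → ℝ} (hD : MemLp D 2 P) {A : Set X} (hA : MeasurableSet A) :
    ∫ x, (D x - A.indicator (fun _ => ∫ y in A, D y ∂P) x) ^ 2 ∂P ≤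
      ∫ x, D x ^ 2 ∂P - (∫ x in A, D x ∂P) ^ 2 := by
  set a := ∫ x in A, D x ∂P
  have hDA : Integrable (A.indicator D) P := (hD.integrable one_le_two).indicator hA
  have hD2 : Integrable (fun x => D x ^ 2) P := hD.integrable_sq
  have h1 : Integrable (A.indicator (1 : X → ℝ)) P := (integrable_const 1).indicator hA
  calc ∫ x, (D x - A.indicator (fun _ => a) x) ^ 2 ∂P
      = ∫ x, (D x ^ 2 - 2 * a * A.indicator D x + a ^ 2 * A.indicator 1 x) ∂P := by
        congr 1 with x
        by_cases hx : x ∈ A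
        · simp only [hx, indicator_of_mem, Pi.one_apply]
          ring
        · simp [hx]
    _ = ∫ x, D x ^ 2 ∂P - 2 * a * a + a ^ 2 * P.real A := by
        rw [integral_add (by exact hD2.sub (hDA.const_mul _)) (h1.const_mul _),
          integral_sub hD2 (hDA.const_mul _), integral_const_mul, integral_const_mul,
          integral_indicator hA, integral_indicator_one hA]
    _ ≤ ∫ x, D x ^ 2 ∂P - a ^ 2 := by
        nlinarith [sq_nonneg a, measureReal_le_one (μ := P) (s := A)]

variable {Ω : Type u} [MeasurableSpace Ω] {μ : Measure Ω} [IsProbabilityMeasure μ]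
  {W : Ω × Ω → ℝ} {ε : ℝ}

theorem exists_isStep_energy_decrement (hW : IsUnitFunction W) {n : ℕ}
    {V : Ω × Ω → unitInterval} (hV : IsStep n V) (hε : 0 ≤ ε)
    (h : ε < cutNorm μ (W - fun p => (V p : ℝ))) :
    ∃ V' : Ω × Ω → unitInterval, IsStep (n * 4) V' ∧
      ∫ p, (W p - V' p) ^ 2 ∂(μ.prod μ) ≤ ∫ p, (W p - V p) ^ 2 ∂(μ.prod μ) - ε ^ 2 := by
  classical
  obtain ⟨S, T, hS, hT, hST⟩ : ∃ S T, MeasurableSet S ∧ MeasurableSet T ∧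
      ε < |∫ p in S ×ˢ T, (W - fun p => (V p : ℝ)) p ∂(μ.prod μ)| := by
    by_contra! hc
    exact h.not_ge (cutNorm_le hc)
  set a := ∫ p in S ×ˢ T, (W - fun p => (V p : ℝ)) p ∂(μ.prod μ)
  have hD : MemLp (W - fun p => (V p : ℝ)) 2 (μ.prod μ) := hW.memLp_sub (.coe hV.measurable)
  have hD' : MemLp (fun p => W p - V p - (S ×ˢ T).indicator (fun _ => a) p) 2 (μ.prod μ) :=
    hD.sub ((memLp_const a).indicator (hS.prod hT))
  let update (v : unitInterval) (b : Prop) : unitInterval :=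
    projIcc 0 1 zero_le_one (v + if b then a else 0)
  refine ⟨_, hV.map₂ (.mem_prod hS hT) update, ?_⟩
  calc ∫ p, (W p - update (V p) (p ∈ S ×ˢ T)) ^ 2 ∂(μ.prod μ)
      ≤ ∫ p, (W p - V p - (S ×ˢ T).indicator (fun _ => a) p) ^ 2 ∂(μ.prod μ) := by
        refine integral_mono_of_nonneg (.of_forall fun _ => sq_nonneg _) hD'.integrable_sq
          (.of_forall fun p => ?_)
        have hclamp := sq_sub_projIcc_le (hW.mem_Icc p)
        by_cases hp : p ∈ S ×ˢ T
        · simpa only [update, hp, if_true, indicator_of_mem, sub_sub] using hclamp (V p + a)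
        · simpa only [update, hp, if_false, not_false_eq_true, indicator_of_notMem, sub_sub]
            using hclamp (V p + 0)
    _ ≤ ∫ p, (W p - V p) ^ 2 ∂(μ.prod μ) - a ^ 2 :=
        integral_sq_sub_indicator_le hD (hS.prod hT)
    _ ≤ ∫ p, (W p - V p) ^ 2 ∂(μ.prod μ) - ε ^ 2 := by
        gcongr ?_ - ?_
        exact sq_le_sq.2 (by rw [abs_of_nonneg hε]; exact hST.le)

theorem exists_isStep_cutNorm_le_or_energy_le (hW : IsUnitFunction W) (hε : 0 ≤ ε) (k : ℕ) :
    ∃ V : Ω × Ω → unitInterval, IsStep (4 ^ k) V ∧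
      (cutNorm μ (W - fun p => (V p : ℝ)) ≤ ε ∨
        ∫ p, (W p - V p) ^ 2 ∂(μ.prod μ) ≤ 1 - k * ε ^ 2) := by
  induction k with
  | zero =>
    refine ⟨_, .const 0, .inr ?_⟩
    have h1 := integral_mono_of_nonneg (μ := μ.prod μ) (.of_forall fun p => sq_nonneg (W p))
      (integrable_const 1) (.of_forall fun p => pow_le_one₀ (hW.nonneg p) (hW.le_one p))
    simpa using h1
  | succ k ih =>
    obtain ⟨V, hV, h⟩ := ih
    by_cases hcut : cutNorm μ (W - fun p => (V p : ℝ)) ≤ ε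
    · exact ⟨V, hV.map₂ (.mem_prod .empty .empty) fun v _ => v, .inl hcut⟩
    · obtain ⟨V', hV', h'⟩ := exists_isStep_energy_decrement hW hV hε (not_le.1 hcut)
      refine ⟨V', hV', .inr (h'.trans ?_)⟩
      push_cast
      linarith [h.resolve_left hcut]

/-- The weak regularity lemma of Frieze and Kannan. -/
theorem exists_isStep_cutNorm_le (hε : 0 < ε) :
    ∃ n : ℕ, ∀ {Ω : Type u} [MeasurableSpace Ω] (μ : Measure Ω) [IsProbabilityMeasure μ]
      {W : Ω × Ω → ℝ}, IsUnitFunction W →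
      ∃ V : Ω × Ω → unitInterval, IsStep n V ∧ cutNorm μ (W - fun p => (V p : ℝ)) ≤ ε := by
  obtain ⟨k, hk⟩ := exists_nat_gt (1 / ε ^ 2)
  rw [div_lt_iff₀ (by positivity)] at hk
  refine ⟨4 ^ k, fun μ _ W hW => ?_⟩
  obtain ⟨V, hV, h | h⟩ := exists_isStep_cutNorm_le_or_energy_le (μ := μ) hW hε.le k
  · exact ⟨V, hV, h⟩
  · have : 0 ≤ ∫ p, (W p - V p) ^ 2 ∂(μ.prod μ) := integral_nonneg fun _ => sq_nonneg _
    linarith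

end Regularity

section Coupling

variable {X Y ι : Type*} [MeasurableSpace X] [MeasurableSpace Y]
  {μ : Measure X} {ν : Measure Y}

theorem inv_measure_univ_smul_smul (μ : Measure X) [IsFiniteMeasure μ] :
    (μ univ)⁻¹ • μ univ • μ = μ := by
  rcases eq_or_ne (μ univ) 0 with h0 | h0
  · rw [Measure.measure_univ_eq_zero.1 h0, smul_zero, smul_zero]
  · rw [smul_smul, ENNReal.inv_mul_cancel h0 (measure_ne_top _ _), one_smul]

/-- The deficient masses `μ - σ.fst` and `ν - σ.snd` are coupled independently. -/
theorem exists_coupling_ge [IsFiniteMeasure μ] [IsFiniteMeasure ν] (hμν : μ univ = ν univ)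
    {σ : Measure (X × Y)} (hfst : σ.fst ≤ μ) (hsnd : σ.snd ≤ ν) :
    ∃ ρ : Measure (X × Y), σ ≤ ρ ∧ ρ.fst = μ ∧ ρ.snd = ν := by
  have : IsFiniteMeasure σ.fst := isFiniteMeasure_of_le μ hfst
  have : IsFiniteMeasure σ.snd := isFiniteMeasure_of_le ν hsnd
  have hdeficit : (ν - σ.snd) univ = (μ - σ.fst) univ := by
    rw [Measure.sub_apply .univ hsnd, Measure.sub_apply .univ hfst, hμν, σ.snd_univ, σ.fst_univ]
  refine ⟨((μ - σ.fst) univ)⁻¹ • (μ - σ.fst).prod (ν - σ.snd) + σ, Measure.le_add_left le_rfl,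
    ?_, ?_⟩
  · rw [Measure.fst_add, Measure.fst, Measure.map_smul, Measure.map_fst_prod, hdeficit,
      inv_measure_univ_smul_smul, Measure.sub_add_cancel_of_le hfst]
  · rw [Measure.snd_add, Measure.snd, Measure.map_smul, Measure.map_snd_prod, ← hdeficit,
      inv_measure_univ_smul_smul, Measure.sub_add_cancel_of_le hsnd]

variable {f : X → ι} {g : Y → ι}

/-- Couple `μ` and `ν` independently inside each common fibre of `f` and `g`, with as much mass
as both fibres have. -/
noncomputable def fiberwiseProd (μ : Measure X) (ν : Measure Y) (f : X → ι) (g : Y → ι) :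
    Measure (X × Y) :=
  .sum fun i => min (μ (f ⁻¹' {i})) (ν (g ⁻¹' {i})) • μ[|f ← i].prod ν[|g ← i]

theorem sum_min_le_fiberwiseProd_setOf_eq [Fintype ι] [IsFiniteMeasure μ] [IsFiniteMeasure ν] :
    ∑ i, min (μ (f ⁻¹' {i})) (ν (g ⁻¹' {i})) ≤ fiberwiseProd μ ν f g {p | f p.1 = g p.2} := by
  rw [fiberwiseProd, Measure.sum_fintype, Measure.finsetSum_apply]
  refine Finset.sum_le_sum fun i _ => ?_
  by_cases h : μ (f ⁻¹' {i}) = 0 ∨ ν (g ⁻¹' {i}) = 0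
  · rcases h with h | h <;> simp [h]
  · obtain ⟨hμ, hν⟩ := not_or.1 h
    have hsub : (f ⁻¹' {i}) ×ˢ (g ⁻¹' {i}) ⊆ {p | f p.1 = g p.2} :=
      fun _ hp => hp.1.trans hp.2.symm
    have hone : μ[|f ← i].prod ν[|g ← i] ((f ⁻¹' {i}) ×ˢ (g ⁻¹' {i})) = 1 := by
      rw [Measure.prod_prod, cond_apply_self hμ (measure_ne_top _ _),
        cond_apply_self hν (measure_ne_top _ _), one_mul]
    rw [Measure.smul_apply, smul_eq_mul]
    exact le_mul_of_one_le_right' (hone.ge.trans (measure_mono hsub))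

variable [MeasurableSpace ι] [DiscreteMeasurableSpace ι]

theorem fst_fiberwiseProd_le [Finite ι] [IsFiniteMeasure μ] (hf : Measurable f) :
    (fiberwiseProd μ ν f g).fst ≤ μ := by
  have := Fintype.ofFinite ι
  refine Measure.le_iff.2 fun S hS => ?_
  conv_rhs => rw [← sum_meas_smul_cond_fiber hf μ, ← Measure.sum_fintype]
  rw [fiberwiseProd, Measure.fst_sum, Measure.sum_apply _ hS, Measure.sum_apply _ hS]
  refine ENNReal.tsum_le_tsum fun i => ?_
  rw [Measure.fst, Measure.map_smul, Measure.map_fst_prod]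
  simp only [Measure.smul_apply, smul_eq_mul]
  gcongr
  · exact min_le_left _ _
  · exact mul_le_of_le_one_left' prob_le_one

theorem snd_fiberwiseProd_le [Finite ι] [IsFiniteMeasure ν] (hg : Measurable g) :
    (fiberwiseProd μ ν f g).snd ≤ ν := by
  have hswap : (fiberwiseProd ν μ g f).map Prod.swap = fiberwiseProd μ ν f g := by
    simp only [fiberwiseProd, Measure.map_sum measurable_swap.aemeasurable, Measure.map_smul,
      Measure.prod_swap, min_comm]
  rw [← hswap, Measure.snd_map_swap]
  exact fst_fiberwiseProd_le hg

theorem exists_coupling_measureReal_ne_le [Fintype ι] [IsProbabilityMeasure μ]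
    [IsProbabilityMeasure ν] (hf : Measurable f) (hg : Measurable g) :
    ∃ ρ : Measure (X × Y), IsProbabilityMeasure ρ ∧
      MeasurePreserving Prod.fst ρ μ ∧ MeasurePreserving Prod.snd ρ ν ∧
      ρ.real {p | f p.1 ≠ g p.2} ≤ ∑ i, |μ.real (f ⁻¹' {i}) - ν.real (g ⁻¹' {i})| := by
  obtain ⟨ρ, hσρ, hfst, hsnd⟩ := exists_coupling_ge (μ := μ) (ν := ν) (by simp)
    (fst_fiberwiseProd_le (ν := ν) (g := g) hf) (snd_fiberwiseProd_le hg)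
  have : IsProbabilityMeasure ρ := ⟨by rw [← ρ.fst_univ, hfst, measure_univ]⟩
  refine ⟨ρ, this, ⟨measurable_fst, hfst⟩, ⟨measurable_snd, hsnd⟩, ?_⟩
  have hE : MeasurableSet {p : X × Y | f p.1 = g p.2} :=
    measurableSet_eq_fun (hf.comp measurable_fst) (hg.comp measurable_snd)
  have hagree : ∑ i, min (μ.real (f ⁻¹' {i})) (ν.real (g ⁻¹' {i})) ≤
      ρ.real {p | f p.1 = g p.2} := by
    have h := (sum_min_le_fiberwiseProd_setOf_eq).trans (hσρ _)
    refine le_trans (le_of_eq ?_) (ENNReal.toReal_mono (measure_ne_top _ _) h)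
    rw [ENNReal.toReal_sum fun i _ => by simp]
    simp only [Measure.real, ENNReal.toReal_min (measure_ne_top _ _) (measure_ne_top _ _)]
  calc ρ.real {p | f p.1 ≠ g p.2} = 1 - ρ.real {p | f p.1 = g p.2} := probReal_compl_eq_one_sub hE
    _ ≤ ∑ i, μ.real (f ⁻¹' {i}) - ∑ i, min (μ.real (f ⁻¹' {i})) (ν.real (g ⁻¹' {i})) := by
        rw [sum_measureReal_preimage_singleton _ fun i _ => hf (.singleton i), Finset.coe_univ,
          preimage_univ, probReal_univ]
        gcongr
    _ ≤ ∑ i, |μ.real (f ⁻¹' {i}) - ν.real (g ⁻¹' {i})| := by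
        rw [← Finset.sum_sub_distrib]
        gcongr with i
        rcases min_choice (μ.real (f ⁻¹' {i})) (ν.real (g ⁻¹' {i})) with h | h <;>
          simp [h, le_abs_self]

theorem exists_coupling_ae_eq [Finite ι] [IsProbabilityMeasure μ] [IsProbabilityMeasure ν]
    (hf : Measurable f) (hg : Measurable g) (hfg : μ.map f = ν.map g) :
    ∃ ρ : Measure (X × Y), IsProbabilityMeasure ρ ∧
      MeasurePreserving Prod.fst ρ μ ∧ MeasurePreserving Prod.snd ρ ν ∧
      ∀ᵐ p ∂ρ, f p.1 = g p.2 := by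
  have := Fintype.ofFinite ι
  obtain ⟨ρ, hprob, hfst, hsnd, hρ⟩ := exists_coupling_measureReal_ne_le (μ := μ) (ν := ν) hf hg
  have hlaw : ∀ i, μ.real (f ⁻¹' {i}) = ν.real (g ⁻¹' {i}) := fun i => by
    rw [← map_measureReal_apply hf (.singleton i), hfg, map_measureReal_apply hg (.singleton i)]
  simp only [hlaw, sub_self, abs_zero, Finset.sum_const_zero] at hρ
  refine ⟨ρ, hprob, hfst, hsnd, ?_⟩
  exact ae_iff.2 ((measureReal_eq_zero_iff).1 (hρ.antisymm measureReal_nonneg))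

end Coupling

section Gluing

variable {X Y Z : Type u} [MeasurableSpace X] [MeasurableSpace Y] [MeasurableSpace Z]
  {μ : Measure X} {ν : Measure Y} {κ : Measure Z} [IsProbabilityMeasure μ]
  [IsProbabilityMeasure ν] [IsProbabilityMeasure κ]

theorem exists_coupling_cutNorm_le {W : Z × Z → ℝ} (hW : IsUnitFunction W) {φ : X → Z} {ψ : Y → Z}
    (hφ : MeasurePreserving φ μ κ) (hψ : MeasurePreserving ψ ν κ) {ε : ℝ} (hε : 0 < ε) :
    ∃ ρ : Measure (X × Y), IsProbabilityMeasure ρ ∧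
      MeasurePreserving Prod.fst ρ μ ∧ MeasurePreserving Prod.snd ρ ν ∧
      cutNorm ρ (W ∘ Prod.map (φ ∘ Prod.fst) (φ ∘ Prod.fst) -
        W ∘ Prod.map (ψ ∘ Prod.snd) (ψ ∘ Prod.snd)) ≤ ε := by
  obtain ⟨n, hreg⟩ := exists_isStep_cutNorm_le (half_pos hε)
  obtain ⟨V, hV, hWV⟩ := hreg κ hW
  have hVunit : IsUnitFunction fun p => (V p : ℝ) := .coe hV.measurable
  obtain ⟨f, hf, U, rfl⟩ := hV
  obtain ⟨ρ, hρ, hfst, hsnd, hfae⟩ := exists_coupling_ae_eq (hf.comp hφ.measurable)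
    (hf.comp hψ.measurable) (by
      rw [← Measure.map_map hf hφ.measurable, ← Measure.map_map hf hψ.measurable, hφ.map_eq,
        hψ.map_eq])
  have hφ' := hφ.comp hfst
  have hψ' := hψ.comp hsnd
  have hVae : (fun p => ((U ∘ Prod.map f f) p : ℝ)) ∘ Prod.map (φ ∘ Prod.fst) (φ ∘ Prod.fst)
      =ᵐ[ρ.prod ρ]
      (fun p => ((U ∘ Prod.map f f) p : ℝ)) ∘ Prod.map (ψ ∘ Prod.snd) (ψ ∘ Prod.snd) := by
    filter_upwards [Measure.quasiMeasurePreserving_fst.ae hfae,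
      Measure.quasiMeasurePreserving_snd.ae hfae] with p h₁ h₂
    exact congrArg (fun q => (U q : ℝ)) (Prod.ext h₁ h₂)
  have hint {h : Z × Z → ℝ} (hh : IsUnitFunction h) {χ : X × Y → Z}
      (hχ : MeasurePreserving χ ρ κ) : Integrable (h ∘ Prod.map χ χ) (ρ.prod ρ) :=
    (hh.comp (hχ.prod hχ).measurable).integrable _
  have hWVi := (hW.integrable (κ.prod κ)).sub (hVunit.integrable (κ.prod κ))
  refine ⟨ρ, hρ, hfst, hsnd, (cutNorm_sub_le (hint hW hφ') (hint hVunit hφ')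
    (hint hW hψ')).trans ?_⟩
  rw [cutNorm_congr_ae (hVae.sub .rfl), cutNorm_sub_comm (_ ∘ Prod.map (ψ ∘ _) _), ← Pi.sub_comp,
    ← Pi.sub_comp, cutNorm_comp hφ' hWVi, cutNorm_comp hψ' hWVi]
  linarith

theorem cutNorm_step_sub_step_le {ι : Type*} [Fintype ι] [MeasurableSpace ι]
    [DiscreteMeasurableSpace ι] {f g : X → ι} (hf : Measurable f) (hg : Measurable g)
    (U V : ι × ι → unitInterval) :
    cutNorm μ ((fun p => (U (Prod.map f f p) : ℝ)) - fun p => (V (Prod.map g g p) : ℝ)) ≤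
      dist U V + 2 * μ.real {x | f x ≠ g x} := by
  set N : Set X := {x | f x ≠ g x}
  have hN : MeasurableSet N := (measurableSet_eq_fun hf hg).compl
  have hunit (U : ι × ι → unitInterval) {f : X → ι} (hf : Measurable f) :
      IsUnitFunction fun p => (U (Prod.map f f p) : ℝ) :=
    .coe ((measurable_of_finite U).comp (hf.prodMap hf))
  have hUV := ((hunit U hf).integrable (μ.prod μ)).sub ((hunit V hg).integrable (μ.prod μ))
  have hint {π : X × X → X} (hπ : MeasurePreserving π (μ.prod μ) μ) :
      Integrable ((π ⁻¹' N).indicator 1 : X × X → ℝ) (μ.prod μ) :=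
    (integrable_const _).indicator (hπ.measurable hN)
  have hpt (p : X × X) : |(U (Prod.map f f p) : ℝ) - V (Prod.map g g p)| ≤
      dist U V + ((Prod.fst ⁻¹' N).indicator 1 p + (Prod.snd ⁻¹' N).indicator 1 p) := by
    by_cases hp : p.1 ∈ N ∨ p.2 ∈ N
    · have hone : (1 : ℝ) ≤ (Prod.fst ⁻¹' N).indicator 1 p + (Prod.snd ⁻¹' N).indicator 1 p := by
        rcases hp with hp | hp <;> simp [indicator_of_mem, hp, indicator_nonneg]
      have := Real.dist_le_of_mem_Icc_01 (U (Prod.map f f p)).2 (V (Prod.map g g p)).2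
      rw [Real.dist_eq] at this
      linarith [dist_nonneg (x := U) (y := V)]
    · obtain ⟨h₁, h₂⟩ : f p.1 = g p.1 ∧ f p.2 = g p.2 := by
        simpa only [N, mem_ofPred_eq, not_or, not_not] using hp
      have hmap : Prod.map f f p = Prod.map g g p := Prod.ext h₁ h₂
      rw [hmap]
      refine (dist_le_pi_dist U V _).trans (le_add_of_nonneg_right (add_nonneg ?_ ?_)) <;>
        exact indicator_nonneg (fun _ _ => zero_le_one) _
  calc _ ≤ ∫ p, |(U (Prod.map f f p) : ℝ) - V (Prod.map g g p)| ∂μ.prod μ :=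
        cutNorm_le_integral_abs hUV
    _ ≤ ∫ p, dist U V + ((Prod.fst ⁻¹' N).indicator 1 p + (Prod.snd ⁻¹' N).indicator 1 p)
          ∂μ.prod μ :=
        integral_mono hUV.abs ((integrable_const _).add
          ((hint measurePreserving_fst).add (hint measurePreserving_snd))) hpt
    _ = dist U V + 2 * μ.real N := by
        rw [integral_add (integrable_const _)
          (by exact (hint measurePreserving_fst).add (hint measurePreserving_snd)),
          integral_add (hint measurePreserving_fst) (hint measurePreserving_snd),
          integral_indicator_one (measurable_fst hN), integral_indicator_one (measurable_snd hN),
          measurePreserving_fst.measureReal_preimage hN.nullMeasurableSet,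
          measurePreserving_snd.measureReal_preimage hN.nullMeasurableSet]
        simp [two_mul]

end Gluing

namespace CutFunction

variable {K₁ K₂ : CutFunction.{u}}

theorem isUnitFunction (K : CutFunction.{u}) : IsUnitFunction K.W := ⟨K.measurable_W, K.W_mem⟩

theorem cutDist_le {Ω : Type u} [MeasurableSpace Ω] {μ : Measure Ω} [hμ : IsProbabilityMeasure μ]
    {φ₁ : Ω → K₁.carrier} {φ₂ : Ω → K₂.carrier} (h₁ : MeasurePreserving φ₁ μ K₁.μ)
    (h₂ : MeasurePreserving φ₂ μ K₂.μ) :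
    cutDist K₁ K₂ ≤ cutNorm μ (K₁.W ∘ Prod.map φ₁ φ₁ - K₂.W ∘ Prod.map φ₂ φ₂) := by
  refine csInf_le ⟨0, ?_⟩ ⟨Ω, _, μ, hμ, φ₁, φ₂, h₁, h₂, rfl⟩
  rintro _ ⟨Ω, _, μ, _, φ₁, φ₂, -, -, rfl⟩
  exact cutNorm_nonneg _

theorem exists_cutNorm_lt {c : ℝ} (hc : cutDist K₁ K₂ < c) :
    ∃ (Ω : Type u) (_ : MeasurableSpace Ω) (μ : Measure Ω) (_ : IsProbabilityMeasure μ)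
      (φ₁ : Ω → K₁.carrier) (φ₂ : Ω → K₂.carrier),
      MeasurePreserving φ₁ μ K₁.μ ∧ MeasurePreserving φ₂ μ K₂.μ ∧
      cutNorm μ (K₁.W ∘ Prod.map φ₁ φ₁ - K₂.W ∘ Prod.map φ₂ φ₂) < c := by
  obtain ⟨_, ⟨Ω, _, μ, hμ, φ₁, φ₂, h₁, h₂, rfl⟩, h⟩ := exists_lt_of_csInf_lt
    (by exact ⟨_, K₁.carrier × K₂.carrier, inferInstance, K₁.μ.prod K₂.μ, inferInstance,
      Prod.fst, Prod.snd, measurePreserving_fst, measurePreserving_snd, rfl⟩) hc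
  exact ⟨Ω, _, μ, hμ, φ₁, φ₂, h₁, h₂, h⟩

theorem cutDist_nonneg (K₁ K₂ : CutFunction.{u}) : 0 ≤ cutDist K₁ K₂ := by
  refine Real.sInf_nonneg ?_
  rintro _ ⟨Ω, _, μ, _, φ₁, φ₂, -, -, rfl⟩
  exact cutNorm_nonneg _

theorem cutDist_comm (K₁ K₂ : CutFunction.{u}) : cutDist K₁ K₂ = cutDist K₂ K₁ := by
  have hle (K₁ K₂ : CutFunction.{u}) : cutDist K₁ K₂ ≤ cutDist K₂ K₁ := by
    refine le_of_forall_gt_imp_ge_of_dense fun c hc => ?_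
    obtain ⟨Ω, _, μ, _, φ₁, φ₂, h₁, h₂, h⟩ := exists_cutNorm_lt hc
    rw [cutNorm_sub_comm] at h
    exact (cutDist_le h₂ h₁).trans h.le
  exact (hle K₁ K₂).antisymm (hle K₂ K₁)

theorem cutDist_self (K : CutFunction.{u}) : cutDist K K = 0 := by
  refine le_antisymm ?_ (cutDist_nonneg K K)
  refine (cutDist_le (MeasurePreserving.id K.μ) (MeasurePreserving.id K.μ)).trans ?_
  simp [cutNorm_le]

theorem cutDist_triangle (K₁ K₂ K₃ : CutFunction.{u}) :
    cutDist K₁ K₃ ≤ cutDist K₁ K₂ + cutDist K₂ K₃ := by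
  refine le_of_forall_pos_le_add fun ε hε => ?_
  obtain ⟨X, _, μ, _, φ₁, φ₂, hφ₁, hφ₂, hφ⟩ := exists_cutNorm_lt
    (lt_add_of_pos_right (cutDist K₁ K₂) (show 0 < ε / 3 by positivity))
  obtain ⟨Y, _, ν, _, ψ₂, ψ₃, hψ₂, hψ₃, hψ⟩ := exists_cutNorm_lt
    (lt_add_of_pos_right (cutDist K₂ K₃) (show 0 < ε / 3 by positivity))
  obtain ⟨ρ, _, hfst, hsnd, hρ⟩ :=
    exists_coupling_cutNorm_le K₂.isUnitFunction hφ₂ hψ₂ (show 0 < ε / 3 by positivity)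
  have hint (K : CutFunction.{u}) {Z : Type u} [MeasurableSpace Z] {κ : Measure Z}
      [IsProbabilityMeasure κ] {χ : Z → K.carrier} (hχ : MeasurePreserving χ κ K.μ) :
      Integrable (K.W ∘ Prod.map χ χ) (κ.prod κ) :=
    (K.isUnitFunction.comp (hχ.prod hχ).measurable).integrable _
  calc cutDist K₁ K₃ ≤ cutNorm ρ (K₁.W ∘ Prod.map (φ₁ ∘ Prod.fst) (φ₁ ∘ Prod.fst) -
        K₃.W ∘ Prod.map (ψ₃ ∘ Prod.snd) (ψ₃ ∘ Prod.snd)) :=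
        cutDist_le (hφ₁.comp hfst) (hψ₃.comp hsnd)
    _ ≤ cutNorm ρ ((K₁.W ∘ Prod.map φ₁ φ₁ - K₂.W ∘ Prod.map φ₂ φ₂) ∘ Prod.map Prod.fst Prod.fst) +
        (cutNorm ρ (K₂.W ∘ Prod.map (φ₂ ∘ Prod.fst) (φ₂ ∘ Prod.fst) -
          K₂.W ∘ Prod.map (ψ₂ ∘ Prod.snd) (ψ₂ ∘ Prod.snd)) +
        cutNorm ρ ((K₂.W ∘ Prod.map ψ₂ ψ₂ - K₃.W ∘ Prod.map ψ₃ ψ₃) ∘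
          Prod.map Prod.snd Prod.snd)) :=
        (cutNorm_sub_le (hint K₁ (hφ₁.comp hfst)) (hint K₂ (hφ₂.comp hfst))
          (hint K₃ (hψ₃.comp hsnd))).trans <| add_le_add_right
          (cutNorm_sub_le (hint K₂ (hφ₂.comp hfst)) (hint K₂ (hψ₂.comp hsnd))
            (hint K₃ (hψ₃.comp hsnd))) _
    _ ≤ cutDist K₁ K₂ + ε / 3 + (ε / 3 + (cutDist K₂ K₃ + ε / 3)) := by
        rw [cutNorm_comp hfst ((hint K₁ hφ₁).sub (hint K₂ hφ₂)),
          cutNorm_comp hsnd ((hint K₂ hψ₂).sub (hint K₃ hψ₃))]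
        gcongr
    _ = cutDist K₁ K₂ + cutDist K₂ K₃ + ε := by ring

theorem cutDist_le_of_step {ι : Type*} [Fintype ι] [MeasurableSpace ι] [DiscreteMeasurableSpace ι]
    {f : K₁.carrier → ι} {g : K₂.carrier → ι} (hf : Measurable f) (hg : Measurable g)
    (U V : ι × ι → unitInterval) :
    cutDist K₁ K₂ ≤ cutNorm K₁.μ (K₁.W - fun p => (U (Prod.map f f p) : ℝ)) +
      (dist U V + 2 * ∑ i, |K₁.μ.real (f ⁻¹' {i}) - K₂.μ.real (g ⁻¹' {i})|) +
      cutNorm K₂.μ (K₂.W - fun p => (V (Prod.map g g p) : ℝ)) := by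
  obtain ⟨ρ, _, hfst, hsnd, hρ⟩ := exists_coupling_measureReal_ne_le (μ := K₁.μ) (ν := K₂.μ) hf hg
  have hunit {X : Type u} [MeasurableSpace X] (U : ι × ι → unitInterval) {f : X → ι}
      (hf : Measurable f) : IsUnitFunction fun p => (U (Prod.map f f p) : ℝ) :=
    .coe ((measurable_of_finite U).comp (hf.prodMap hf))
  have hUf := hunit U hf
  have hVg := hunit V hg
  have hint {X : Type u} [MeasurableSpace X] {W : X × X → ℝ} (hW : IsUnitFunction W)
      {π : K₁.carrier × K₂.carrier → X} (hπ : Measurable π) :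
      Integrable (W ∘ Prod.map π π) (ρ.prod ρ) := (hW.comp (hπ.prodMap hπ)).integrable _
  have h₁ := cutNorm_sub_le (hint K₁.isUnitFunction measurable_fst) (hint hUf measurable_fst)
    (hint K₂.isUnitFunction measurable_snd)
  have h₂ := cutNorm_sub_le (hint hUf measurable_fst) (hint hVg measurable_snd)
    (hint K₂.isUnitFunction measurable_snd)
  have h₃ : cutNorm ρ ((fun p => (U (Prod.map f f p) : ℝ)) ∘ Prod.map Prod.fst Prod.fst -
      (fun p => (V (Prod.map g g p) : ℝ)) ∘ Prod.map Prod.snd Prod.snd) ≤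
      dist U V + 2 * ρ.real {p | f p.1 ≠ g p.2} :=
    cutNorm_step_sub_step_le (hf.comp measurable_fst) (hg.comp measurable_snd) U V
  rw [← Pi.sub_comp, cutNorm_comp hfst ((K₁.isUnitFunction.integrable _).sub (hUf.integrable _))]
    at h₁
  rw [cutNorm_sub_comm (_ ∘ Prod.map Prod.snd _), ← Pi.sub_comp,
    cutNorm_comp hsnd ((K₂.isUnitFunction.integrable _).sub (hVg.integrable _))] at h₂
  linarith [cutDist_le hfst hsnd]

theorem cutEquiv_equivalence : Equivalence CutEquiv.{u} where
  refl := cutDist_self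
  symm h := (cutDist_comm _ _).trans h
  trans {K₁ K₂ K₃} h h' := le_antisymm
    ((cutDist_triangle K₁ K₂ K₃).trans (by rw [h, h', add_zero])) (cutDist_nonneg _ _)

end CutFunction

namespace CutSpace

open CutFunction

theorem mk_eq_mk {K₁ K₂ : CutFunction.{u}} : mk K₁ = mk K₂ ↔ CutEquiv K₁ K₂ :=
  ⟨fun h => cutEquiv_equivalence.eqvGen_iff.1 (Quot.eqvGen_exact h), Quot.sound⟩

theorem mk_out (x : CutSpace.{u}) : mk (Quot.out x) = x := Quot.out_eq x

noncomputable instance : MetricSpace CutSpace.{u} where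
  dist x y := cutDist (Quot.out x) (Quot.out y)
  dist_self _ := cutDist_self _
  dist_comm _ _ := cutDist_comm _ _
  dist_triangle _ _ _ := cutDist_triangle _ _ _
  eq_of_dist_eq_zero {x y} h := by
    rw [← mk_out x, ← mk_out y]
    exact mk_eq_mk.2 h

theorem dist_mk_mk (K₁ K₂ : CutFunction.{u}) : dist (mk K₁) (mk K₂) = cutDist K₁ K₂ := by
  change cutDist (Quot.out (mk K₁)) (Quot.out (mk K₂)) = _
  have hout (K : CutFunction.{u}) : cutDist (Quot.out (mk K)) K = 0 := mk_eq_mk.1 (mk_out _)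
  have hout' (K : CutFunction.{u}) : cutDist K (Quot.out (mk K)) = 0 :=
    (cutDist_comm _ _).trans (hout K)
  apply le_antisymm
  · linarith [hout K₁, hout' K₂, cutDist_triangle (Quot.out (mk K₁)) K₁ (Quot.out (mk K₂)),
      cutDist_triangle K₁ K₂ (Quot.out (mk K₂))]
  · linarith [hout' K₁, hout K₂, cutDist_triangle K₁ (Quot.out (mk K₁)) K₂,
      cutDist_triangle (Quot.out (mk K₁)) (Quot.out (mk K₂)) K₂]

end CutSpace

section WeakLimit

variable {α : Type*}

theorem exists_forall_tendsto_inner {E : Type*} [NormedAddCommGroup E] [InnerProductSpace ℝ E]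
    [CompleteSpace E] (F : Ultrafilter α) {v : α → E} {C : ℝ} (hv : ∀ a, ‖v a‖ ≤ C) :
    ∃ w : E, ∀ g, Tendsto (fun a => inner ℝ (v a) g) F (𝓝 (inner ℝ w g)) := by
  let L (a : α) : WeakDual ℝ E := StrongDual.toWeakDual (InnerProductSpace.toDual ℝ E (v a))
  have hL : ∀ a, L a ∈ WeakDual.toStrongDual ⁻¹' Metric.closedBall 0 C := fun a => by
    simpa [L] using hv a
  obtain ⟨w, -, hw⟩ := (WeakDual.isCompact_closedBall 0 C).ultrafilter_le_nhds (F.map L)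
    (le_principal_iff.2 (mem_map.2 (univ_mem' hL)))
  refine ⟨(InnerProductSpace.toDual ℝ E).symm (WeakDual.toStrongDual w), fun g => ?_⟩
  rw [InnerProductSpace.toDual_symm_apply]
  exact ((WeakDual.eval_continuous g).tendsto w).comp hw

variable {Z : Type*} [MeasurableSpace Z] {P : Measure Z}

theorem IsUnitFunction.exists_ae_eq {w : Z → ℝ} (hw : AEMeasurable w P)
    (hmem : ∀ᵐ z ∂P, w z ∈ Icc (0 : ℝ) 1) : ∃ W, IsUnitFunction W ∧ W =ᵐ[P] w := by
  refine ⟨fun z => projIcc 0 1 (zero_le_one (α := ℝ)) (hw.mk w z),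
    .coe (continuous_projIcc.measurable.comp hw.measurable_mk), ?_⟩
  filter_upwards [hw.ae_eq_mk, hmem] with z hz hz01
  rw [← hz, projIcc_of_mem _ hz01]

theorem exists_isUnitFunction_tendsto_setIntegral [IsFiniteMeasure P] (F : Ultrafilter α)
    {V : α → Z → ℝ} (hV : ∀ a, IsUnitFunction (V a)) :
    ∃ W : Z → ℝ, IsUnitFunction W ∧ ∀ A, MeasurableSet A →
      Tendsto (fun a => ∫ z in A, V a z ∂P) F (𝓝 (∫ z in A, W z ∂P)) := by
  have hL (a : α) : MemLp (V a) 2 P :=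
    .of_bound (hV a).measurable.aestronglyMeasurable 1 (.of_forall (hV a).norm_le_one)
  have hbound (a : α) : ‖(hL a).toLp‖ ≤ _ := Lp.norm_le_of_ae_bound zero_le_one <| by
    filter_upwards [(hL a).coeFn_toLp] with z hz using hz ▸ (hV a).norm_le_one z
  obtain ⟨w, hw⟩ := exists_forall_tendsto_inner F hbound
  have hlim (A : Set Z) (hA : MeasurableSet A) :
      Tendsto (fun a => ∫ z in A, V a z ∂P) F (𝓝 (∫ z in A, w z ∂P)) := by
    have h := hw (indicatorConstLp 2 hA (measure_ne_top P A) (1 : ℝ))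
    simp only [real_inner_comm (indicatorConstLp 2 hA _ _), L2.inner_indicatorConstLp_one] at h
    exact h.congr fun a => integral_congr_ae (ae_restrict_of_ae (hL a).coeFn_toLp)
  have hwi : Integrable w P := (Lp.memLp w).integrable one_le_two
  have hnonneg : ∀ᵐ z ∂P, 0 ≤ w z := ae_nonneg_of_forall_setIntegral_nonneg hwi fun A hA _ =>
    ge_of_tendsto' (hlim A hA) fun a => integral_nonneg (hV a).nonneg
  have hle_one : ∀ᵐ z ∂P, w z ≤ 1 := ae_le_of_forall_setIntegral_le hwi (integrable_const 1)
    fun A hA _ => le_of_tendsto' (hlim A hA) fun a =>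
      integral_mono ((hV a).integrable _) (integrable_const 1) (hV a).le_one
  obtain ⟨W, hW, hWw⟩ := IsUnitFunction.exists_ae_eq hwi.aemeasurable (hnonneg.and hle_one)
  refine ⟨W, hW, fun A hA => ?_⟩
  rw [integral_congr_ae (ae_restrict_of_ae hWw)]
  exact hlim A hA

end WeakLimit

section CutNormLimit

theorem exists_isUnitFunction_cutNorm_sub_le {Ω : Type u} [MeasurableSpace Ω] {μ : Measure Ω}
    [IsFiniteMeasure μ] {V : ℕ → Ω × Ω → ℝ} (hV : ∀ k, IsUnitFunction (V k)) {ε : ℕ → ℝ}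
    (hε : Tendsto ε atTop (𝓝 0)) (hcauchy : ∀ k l, cutNorm μ (V k - V l) ≤ ε k + ε l) :
    ∃ W : Ω × Ω → ℝ, IsUnitFunction W ∧ ∀ k, cutNorm μ (W - V k) ≤ ε k := by
  obtain ⟨W, hW, hlim⟩ :=
    exists_isUnitFunction_tendsto_setIntegral (P := μ.prod μ) (hyperfilter ℕ) hV
  have hVi (k : ℕ) := (hV k).integrable (μ.prod μ)
  refine ⟨W, hW, fun k => cutNorm_le fun S T hS hT => ?_⟩
  have hdiff : Tendsto (fun l => |∫ p in S ×ˢ T, (V l - V k) p ∂μ.prod μ|) (hyperfilter ℕ)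
      (𝓝 |∫ p in S ×ˢ T, (W - V k) p ∂μ.prod μ|) := by
    simp only [Pi.sub_apply, integral_sub (hVi _).integrableOn (hVi k).integrableOn,
      integral_sub (hW.integrable _).integrableOn (hVi k).integrableOn]
    exact ((hlim _ (hS.prod hT)).sub_const _).abs
  have hbound : Tendsto (fun l => ε l + ε k) (hyperfilter ℕ) (𝓝 (ε k)) := by
    simpa using (hε.mono_left Nat.hyperfilter_le_atTop).add_const (ε k)
  exact le_of_tendsto_of_tendsto' hdiff hbound fun l =>
    (abs_setIntegral_le_cutNorm ((hVi l).sub (hVi k)) hS hT).trans (hcauchy l k)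

variable {α ι : Type*} {F : Filter α} [F.NeBot] [Finite ι] {c : ℝ}

theorem cutNorm_le_of_tendsto_of_finite [MeasurableSpace ι] [DiscreteMeasurableSpace ι]
    {P : α → Measure ι} [∀ a, IsFiniteMeasure (P a)] {Q : Measure ι} [IsFiniteMeasure Q]
    (hP : ∀ i, Tendsto (fun a => (P a).real {i}) F (𝓝 (Q.real {i})))
    {D : α → ι × ι → ℝ} {E : ι × ι → ℝ} (hD : Tendsto D F (𝓝 E))
    (hc : ∀ a, cutNorm (P a) (D a) ≤ c) : cutNorm Q E ≤ c := by
  have := Fintype.ofFinite ι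
  have hint (P : Measure ι) [IsFiniteMeasure P] (D : ι × ι → ℝ) (S T : Set ι) :
      ∫ p in S ×ˢ T, D p ∂P.prod P =
        ∑ p, P.real {p.1} * P.real {p.2} * (S ×ˢ T).indicator D p := by
    rw [← integral_indicator (.of_discrete), integral_fintype .of_finite]
    simp only [← measureReal_prod_prod, singleton_prod_singleton, smul_eq_mul]
  refine cutNorm_le fun S T hS hT => ?_
  have hle (a : α) : |∫ p in S ×ˢ T, D a p ∂(P a).prod (P a)| ≤ c :=
    (abs_setIntegral_le_cutNorm .of_finite hS hT).trans (hc a)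
  refine le_of_tendsto' (x := F) ?_ hle
  simp only [hint]
  refine (tendsto_finsetSum _ fun p _ => ((hP p.1).mul (hP p.2)).mul ?_).abs
  by_cases hp : p ∈ S ×ˢ T
  · simpa only [indicator_of_mem hp] using tendsto_pi_nhds.1 hD p
  · simp only [indicator_of_notMem hp, tendsto_const_nhds]

theorem tendsto_measureReal_preimage_singleton {α ι : Type*} {F : Filter α} {Y : Type*}
    [TopologicalSpace Y] [MeasurableSpace Y]
    [OpensMeasurableSpace Y] [HasOuterApproxClosed Y] [TopologicalSpace ι] [DiscreteTopology ι]
    {ν : α → ProbabilityMeasure Y} {ν' : ProbabilityMeasure Y} (hν : Tendsto ν F (𝓝 ν'))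
    {π : Y → ι} (hπ : Continuous π) (i : ι) :
    Tendsto (fun a => (ν a : Measure Y).real (π ⁻¹' {i})) F
      (𝓝 ((ν' : Measure Y).real (π ⁻¹' {i}))) :=
  NNReal.tendsto_coe.2 (ProbabilityMeasure.tendsto_measure_of_isClopen_of_tendsto hν
    ((isClopen_discrete {i}).preimage hπ))

theorem cutNorm_le_of_tendsto {Y : Type u} [TopologicalSpace Y] [MeasurableSpace Y]
    [OpensMeasurableSpace Y] [HasOuterApproxClosed Y] {ν : α → ProbabilityMeasure Y}
    {ν' : ProbabilityMeasure Y} (hν : Tendsto ν F (𝓝 ν')) [TopologicalSpace ι] [DiscreteTopology ι]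
    {π : Y → ι} (hπ : Continuous π) {D : α → ι × ι → ℝ} {E : ι × ι → ℝ}
    (hD : Tendsto D F (𝓝 E)) (hc : ∀ a, cutNorm (ν a : Measure Y) (D a ∘ Prod.map π π) ≤ c) :
    cutNorm (ν' : Measure Y) (E ∘ Prod.map π π) ≤ c := by
  borelize ι
  have hlaw (ν : ProbabilityMeasure Y) (D : ι × ι → ℝ) :
      cutNorm (ν : Measure Y) (D ∘ Prod.map π π) = cutNorm ((ν : Measure Y).map π) D :=
    cutNorm_comp (hπ.measurable.measurePreserving _) .of_finite
  simp only [hlaw] at hc ⊢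
  refine cutNorm_le_of_tendsto_of_finite (fun i => ?_) hD hc
  simp only [map_measureReal_apply hπ.measurable (.singleton i)]
  exact tendsto_measureReal_preimage_singleton hν hπ i

end CutNormLimit

/-- The `k`-th of a sequence of step functions, as a function of the labels of the two points: only
their `k`-th coordinates matter. -/
def labelKernel {m : ℕ → ℕ} (U : ∀ k, Fin (m k) × Fin (m k) → unitInterval) (k : ℕ)
    (p : (∀ k, Fin (m k)) × ∀ k, Fin (m k)) : ℝ :=
  U k (p.1 k, p.2 k)

theorem isUnitFunction_labelKernel {m : ℕ → ℕ} (U : ∀ k, Fin (m k) × Fin (m k) → unitInterval)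
    (k : ℕ) : IsUnitFunction (labelKernel U k) :=
  .coe ((measurable_of_finite (U k)).comp (by fun_prop))

/-- A sequence of step functions approximating a kernel in cut norm, the `k`-th one being constant
on the boxes of a partition into `m k` sets and having error `ε k`. The partitions are recorded as
a single map `f` to a compact space, so that the law of `f` determines all their joint laws. -/
structure StepApprox (m : ℕ → ℕ) (ε : ℕ → ℝ) (K : CutFunction.{u}) where
  f : K.carrier → ∀ k, Fin (m k)
  measurable_f : Measurable f
  U : ∀ k, Fin (m k) × Fin (m k) → unitInterval
  cutNorm_le : ∀ k, cutNorm K.μ (K.W - labelKernel U k ∘ Prod.map f f) ≤ ε k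

namespace StepApprox

variable {m : ℕ → ℕ} {ε : ℕ → ℝ}

theorem exists_forall_nonempty (hε : ∀ k, 0 < ε k) :
    ∃ m, ∀ K : CutFunction.{u}, Nonempty (StepApprox m ε K) := by
  choose m hm using fun k => exists_isStep_cutNorm_le.{u} (hε k)
  refine ⟨m, fun K => ?_⟩
  choose V hstep hle using fun k => hm k K.μ K.isUnitFunction
  choose f hf U hV using hstep
  exact ⟨fun x k => f k x, measurable_pi_iff.2 hf, U, fun k => by simpa only [hV] using! hle k⟩

/-- The law of the label of a random point. -/
noncomputable def law {K : CutFunction.{u}} (A : StepApprox m ε K) :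
    ProbabilityMeasure (∀ k, Fin (m k)) :=
  ⟨K.μ.map A.f, Measure.isProbabilityMeasure_map A.measurable_f.aemeasurable⟩

theorem measurePreserving_f {K : CutFunction.{u}} (A : StepApprox m ε K) :
    MeasurePreserving A.f K.μ (A.law : Measure (∀ k, Fin (m k))) :=
  A.measurable_f.measurePreserving K.μ

theorem cutNorm_labelKernel_sub_le {K : CutFunction.{u}} (A : StepApprox m ε K) (k l : ℕ) :
    cutNorm (A.law : Measure (∀ k, Fin (m k))) (labelKernel A.U k - labelKernel A.U l) ≤
      ε k + ε l := by
  have hi (k : ℕ) := (isUnitFunction_labelKernel A.U k).integrable (A.law.toMeasure.prod A.law)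
  have hi' (k : ℕ) : Integrable (labelKernel A.U k ∘ Prod.map A.f A.f) (K.μ.prod K.μ) :=
    ((isUnitFunction_labelKernel A.U k).comp
      (A.measurable_f.prodMap A.measurable_f)).integrable _
  rw [← cutNorm_comp A.measurePreserving_f ((hi k).sub (hi l)), Pi.sub_comp]
  refine (cutNorm_sub_le (hi' k) (K.isUnitFunction.integrable _) (hi' l)).trans ?_
  rw [cutNorm_sub_comm]
  exact add_le_add (A.cutNorm_le k) (A.cutNorm_le l)

/-- The labels themselves, lifted to the universe of the kernels, carry the limiting kernel. -/
theorem exists_of_law (hε : Tendsto ε atTop (𝓝 0)) (ν : ProbabilityMeasure (∀ k, Fin (m k)))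
    (U : ∀ k, Fin (m k) × Fin (m k) → unitInterval)
    (h : ∀ k l, cutNorm (ν : Measure (∀ k, Fin (m k))) (labelKernel U k - labelKernel U l) ≤
      ε k + ε l) :
    ∃ (L : CutFunction.{u}) (B : StepApprox m ε L), B.law = ν ∧ B.U = U := by
  obtain ⟨W, hW, hWle⟩ :=
    exists_isUnitFunction_cutNorm_sub_le (isUnitFunction_labelKernel U) hε h
  let μ : Measure (ULift.{u} (∀ k, Fin (m k))) := (ν : Measure (∀ k, Fin (m k))).map ULift.up
  have : IsProbabilityMeasure μ := Measure.isProbabilityMeasure_map measurable_up.aemeasurable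
  have hdown : MeasurePreserving ULift.down μ (ν : Measure (∀ k, Fin (m k))) :=
    ⟨measurable_down, (Measure.map_map measurable_down measurable_up).trans Measure.map_id⟩
  have hWdown := hW.comp (hdown.prod hdown).measurable
  let L : CutFunction.{u} := ⟨ULift.{u} (∀ k, Fin (m k)), μ, _, hWdown.measurable, hWdown.mem_Icc⟩
  refine ⟨L, ⟨ULift.down, measurable_down, U, fun k => ?_⟩, Subtype.ext hdown.map_eq, rfl⟩
  refine le_trans (le_of_eq ?_) (hWle k)
  exact cutNorm_comp hdown
    ((hW.integrable _).sub ((isUnitFunction_labelKernel U k).integrable _))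

theorem exists_tendsto {α : Type*} (hε : Tendsto ε atTop (𝓝 0)) (F : Ultrafilter α)
    {K : α → CutFunction.{u}} (A : ∀ a, StepApprox m ε (K a)) :
    ∃ (L : CutFunction.{u}) (B : StepApprox m ε L),
      Tendsto (fun a => (A a).law) F (𝓝 B.law) ∧ Tendsto (fun a => (A a).U) F (𝓝 B.U) := by
  have hν : Tendsto (fun a => (A a).law) F (𝓝 (F.map fun a => (A a).law).lim) :=
    (F.map fun a => (A a).law).le_nhds_lim
  have hU : Tendsto (fun a => (A a).U) F (𝓝 (F.map fun a => (A a).U).lim) :=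
    (F.map fun a => (A a).U).le_nhds_lim
  obtain ⟨L, B, hlaw, hBU⟩ := exists_of_law hε _ _ fun k l =>
    cutNorm_le_of_tendsto hν (π := fun y => (y k, y l)) (by fun_prop)
      (D := fun a p => ((A a).U k (p.1.1, p.2.1) : ℝ) - (A a).U l (p.1.2, p.2.2))
      (E := fun p => _ - _) (tendsto_pi_nhds.2 fun p => .sub
        (continuous_subtype_val.tendsto _ |>.comp
          (tendsto_pi_nhds.1 (tendsto_pi_nhds.1 hU k) (p.1.1, p.2.1)))
        (continuous_subtype_val.tendsto _ |>.comp
          (tendsto_pi_nhds.1 (tendsto_pi_nhds.1 hU l) (p.1.2, p.2.2))))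
      fun a => (A a).cutNorm_labelKernel_sub_le k l
  exact ⟨L, B, hlaw ▸ hν, hBU ▸ hU⟩

theorem tendsto_cutDist {α : Type*} (hε : Tendsto ε atTop (𝓝 0)) {F : Filter α}
    {K : α → CutFunction.{u}} {L : CutFunction.{u}} (A : ∀ a, StepApprox m ε (K a))
    (B : StepApprox m ε L) (hlaw : Tendsto (fun a => (A a).law) F (𝓝 B.law))
    (hU : Tendsto (fun a => (A a).U) F (𝓝 B.U)) :
    Tendsto (fun a => (K a).cutDist L) F (𝓝 0) := by
  let bound (k : ℕ) (a : α) : ℝ := ε k + (dist ((A a).U k) (B.U k) +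
    2 * ∑ i, |(K a).μ.real ((fun x => (A a).f x k) ⁻¹' {i}) -
      L.μ.real ((fun x => B.f x k) ⁻¹' {i})|) + ε k
  have hbound (k : ℕ) (a : α) : (K a).cutDist L ≤ bound k a :=
    (CutFunction.cutDist_le_of_step (measurable_pi_iff.1 (A a).measurable_f k)
      (measurable_pi_iff.1 B.measurable_f k) ((A a).U k) (B.U k)).trans
      (add_le_add (add_le_add_left ((A a).cutNorm_le k) _) (B.cutNorm_le k))
  have hreal {K : CutFunction.{u}} (A : StepApprox m ε K) (k : ℕ) (i : Fin (m k)) :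
      K.μ.real ((fun x => A.f x k) ⁻¹' {i}) =
        (A.law : Measure (∀ k, Fin (m k))).real ((fun y => y k) ⁻¹' {i}) :=
    (A.measurePreserving_f.measureReal_preimage
      (measurable_pi_apply k (.singleton i)).nullMeasurableSet)
  have hlim (k : ℕ) :
      Tendsto (bound k) F (𝓝 (ε k + (0 + 2 * ∑ _i : Fin (m k), 0) + ε k)) := by
    refine (((tendsto_iff_dist_tendsto_zero.1 (tendsto_pi_nhds.1 hU k)).add (.const_mul 2
      (tendsto_finsetSum Finset.univ fun i _ => ?_))).const_add (ε k)).add_const (ε k)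
    simp only [hreal]
    exact tendsto_iff_dist_tendsto_zero.1
      (tendsto_measureReal_preimage_singleton hlaw (continuous_apply k) i)
  refine tendsto_order.2 ⟨fun c hc => .of_forall fun a => hc.trans_le
    (CutFunction.cutDist_nonneg _ _), fun c hc => ?_⟩
  obtain ⟨k, hk⟩ := (hε.eventually_lt_const (half_pos hc)).exists
  have hlt : ε k + (0 + 2 * ∑ _i : Fin (m k), (0 : ℝ)) + ε k < c := by
    simp only [Finset.sum_const_zero]
    linarith
  filter_upwards [(hlim k).eventually_lt_const hlt] with a ha using (hbound k a).trans_lt ha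

end StepApprox

namespace CutSpace

theorem exists_le_nhds (F : Ultrafilter CutSpace.{u}) : ∃ x : CutSpace.{u}, ↑F ≤ 𝓝 x := by
  obtain ⟨m, hm⟩ := StepApprox.exists_forall_nonempty.{u}
    (ε := fun k => 1 / ((k : ℝ) + 1)) fun k => by positivity
  have hε := tendsto_one_div_add_atTop_nhds_zero_nat (𝕜 := ℝ)
  let A (x : CutSpace.{u}) := (hm (Quot.out x)).some
  obtain ⟨L, B, hlaw, hU⟩ := StepApprox.exists_tendsto hε F A
  refine ⟨mk L, tendsto_iff_dist_tendsto_zero.2 ?_⟩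
  refine (StepApprox.tendsto_cutDist hε A B hlaw hU).congr fun x => ?_
  rw [← dist_mk_mk, mk_out]

instance : CompactSpace CutSpace.{u} where
  isCompact_univ := isCompact_iff_ultrafilter_le_nhds.2 fun F _ =>
    let ⟨x, hx⟩ := exists_le_nhds F
    ⟨x, mem_univ x, hx⟩

end CutSpace

section TriangleDensity

variable {Ω : Type u} [MeasurableSpace Ω]

/-- The cyclic rotation `(x, y, z) ↦ (y, z, x)`. -/
def tripleRotation (t : Ω × Ω × Ω) : Ω × Ω × Ω := (t.2.1, t.2.2, t.1)

theorem measurePreserving_tripleRotation (μ : Measure Ω) [SFinite μ] :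
    MeasurePreserving tripleRotation (μ.prod (μ.prod μ)) (μ.prod (μ.prod μ)) :=
  (measurePreserving_prodAssoc μ μ μ).comp
    (Measure.measurePreserving_swap (μ := μ) (ν := μ.prod μ))

/-- The weight `f (x, y) * g (y, z) * h (z, x)` of the triangle `(x, y, z)`, as integrated in the
triangle density. -/
def triangleWeight (f g h : Ω × Ω → ℝ) (t : Ω × Ω × Ω) : ℝ :=
  f (t.1, t.2.1) * g t.2 * h (t.2.2, t.1)

/-- The homomorphism density of the directed triangle with edge weights `f`, `g`, `h`. -/
noncomputable def triangleDensity (μ : Measure Ω) (f g h : Ω × Ω → ℝ) : ℝ :=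
  ∫ t, triangleWeight f g h t ∂(μ.prod (μ.prod μ))

variable {f f' g g' h h' : Ω × Ω → ℝ}

theorem IsUnitFunction.triangleWeight (hf : IsUnitFunction f) (hg : IsUnitFunction g)
    (hh : IsUnitFunction h) : IsUnitFunction (triangleWeight f g h) :=
  ((hf.comp (by fun_prop)).mul (hg.comp measurable_snd)).mul (hh.comp (by fun_prop))

theorem triangleDensity_comp {Ω' : Type*} [MeasurableSpace Ω'] {μ' : Measure Ω'} [SFinite μ']
    {μ : Measure Ω} {φ : Ω' → Ω} (hφ : MeasurePreserving φ μ' μ)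
    (hf : IsUnitFunction f) (hg : IsUnitFunction g) (hh : IsUnitFunction h) :
    triangleDensity μ' (f ∘ Prod.map φ φ) (g ∘ Prod.map φ φ) (h ∘ Prod.map φ φ) =
      triangleDensity μ f g h := by
  have hφ₃ := hφ.prod (hφ.prod hφ)
  rw [triangleDensity, triangleDensity, ← hφ₃.map_eq,
    integral_map hφ₃.measurable.aemeasurable
      (hf.triangleWeight hg hh).measurable.aestronglyMeasurable]
  rfl

theorem triangleDensity_rotate (μ : Measure Ω) [SFinite μ] (hf : IsUnitFunction f)
    (hg : IsUnitFunction g) (hh : IsUnitFunction h) :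
    triangleDensity μ f g h = triangleDensity μ g h f := by
  have hrot := measurePreserving_tripleRotation μ
  rw [triangleDensity, triangleDensity, ← hrot.map_eq,
    integral_map hrot.measurable.aemeasurable
      (hg.triangleWeight hh hf).measurable.aestronglyMeasurable, hrot.map_eq]
  congr 1 with t
  simp only [triangleWeight, tripleRotation]
  ring

variable {μ : Measure Ω} [IsProbabilityMeasure μ]

theorem abs_triangleDensity_sub_le_middle (hf : IsUnitFunction f) (hg : IsUnitFunction g)
    (hg' : IsUnitFunction g') (hh : IsUnitFunction h) :
    |triangleDensity μ f g h - triangleDensity μ f g' h| ≤ cutNorm μ (g - g') := by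
  have hi := (hf.triangleWeight hg hh).integrable (μ.prod (μ.prod μ))
  have hi' := (hf.triangleWeight hg' hh).integrable (μ.prod (μ.prod μ))
  have hsection (x : Ω) :
      ‖∫ p, (triangleWeight f g h - triangleWeight f g' h) (x, p) ∂(μ.prod μ)‖ ≤
        cutNorm μ (g - g') := by
    rw [Real.norm_eq_abs]
    convert abs_integral_mul_mul_le_cutNorm (f := fun y => f (x, y)) (g := fun z => h (z, x))
      ((hg.integrable (μ.prod μ)).sub (hg'.integrable _)) (hf.comp measurable_prodMk_left)
      (hh.comp measurable_prodMk_right) using 4 with p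
    simp only [triangleWeight, Pi.sub_apply]
    ring
  rw [triangleDensity, triangleDensity, ← integral_sub' hi hi', integral_prod _ (hi.sub hi')]
  simpa using norm_integral_le_of_norm_le_const (μ := μ) (.of_forall hsection)

theorem abs_triangleDensity_sub_le (hf : IsUnitFunction f) (hf' : IsUnitFunction f')
    (hg : IsUnitFunction g) (hg' : IsUnitFunction g') (hh : IsUnitFunction h)
    (hh' : IsUnitFunction h') :
    |triangleDensity μ f g h - triangleDensity μ f' g' h'| ≤
      cutNorm μ (f - f') + cutNorm μ (g - g') + cutNorm μ (h - h') := by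
  have h₁ : |triangleDensity μ f g h - triangleDensity μ f' g h| ≤ cutNorm μ (f - f') := by
    simpa only [← triangleDensity_rotate μ hf hg hh, ← triangleDensity_rotate μ hf' hg hh,
      ← triangleDensity_rotate μ hh hf hg, ← triangleDensity_rotate μ hh hf' hg]
      using abs_triangleDensity_sub_le_middle (μ := μ) hh hf hf' hg
  have h₂ : |triangleDensity μ f' g h - triangleDensity μ f' g' h| ≤ cutNorm μ (g - g') :=
    abs_triangleDensity_sub_le_middle hf' hg hg' hh
  have h₃ : |triangleDensity μ f' g' h - triangleDensity μ f' g' h'| ≤ cutNorm μ (h - h') := by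
    simpa only [triangleDensity_rotate μ hf' hg' hh, triangleDensity_rotate μ hf' hg' hh']
      using abs_triangleDensity_sub_le_middle (μ := μ) hg' hh hh' hf'
  linarith [abs_sub_le (triangleDensity μ f g h) (triangleDensity μ f' g h)
    (triangleDensity μ f' g' h'), abs_sub_le (triangleDensity μ f' g h)
    (triangleDensity μ f' g' h) (triangleDensity μ f' g' h')]

theorem triangleDensity_nonneg (μ : Measure Ω) (hf : IsUnitFunction f) (hg : IsUnitFunction g)
    (hh : IsUnitFunction h) : 0 ≤ triangleDensity μ f g h :=
  integral_nonneg (hf.triangleWeight hg hh).nonneg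

theorem triangleDensity_eq_zero_iff (hf : IsUnitFunction f) (hg : IsUnitFunction g)
    (hh : IsUnitFunction h) :
    triangleDensity μ f g h = 0 ↔ triangleWeight f g h =ᵐ[μ.prod (μ.prod μ)] 0 :=
  integral_eq_zero_iff_of_nonneg (hf.triangleWeight hg hh).nonneg
    ((hf.triangleWeight hg hh).integrable _)

end TriangleDensity

section PosetDefect

theorem IsUnitFunction.one_sub {X : Type*} [MeasurableSpace X] {f : X → ℝ}
    (hf : IsUnitFunction f) : IsUnitFunction (1 - f) :=
  ⟨hf.measurable.const_sub 1, fun x => ⟨sub_nonneg.2 (hf.le_one x), sub_le_self _ (hf.nonneg x)⟩⟩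

/-- The density of the violations of the poset kernel axioms by `W`: of the failures
`W (x, z) ≠ 1` of transitivity, and of the directed cycles, on triples with `W (x, y)` and
`W (y, z)` positive. -/
noncomputable def posetDefect {Ω : Type*} [MeasurableSpace Ω] (μ : Measure Ω) (W : Ω × Ω → ℝ) :
    ℝ :=
  triangleDensity μ W W ((1 - W) ∘ Prod.swap) + triangleDensity μ W W W

theorem posetDefect_comp {Ω Ω' : Type*} [MeasurableSpace Ω] [MeasurableSpace Ω']
    {μ : Measure Ω} [SFinite μ] {μ' : Measure Ω'} [SFinite μ'] {φ : Ω' → Ω}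
    (hφ : MeasurePreserving φ μ' μ) {W : Ω × Ω → ℝ} (hW : IsUnitFunction W) :
    posetDefect μ' (W ∘ Prod.map φ φ) = posetDefect μ W := by
  have htrans := triangleDensity_comp hφ hW hW (hW.one_sub.comp measurable_swap)
  exact congrArg₂ _ htrans (triangleDensity_comp hφ hW hW hW)

variable {Ω : Type u} [MeasurableSpace Ω] {μ : Measure Ω} [IsProbabilityMeasure μ]
  {V W : Ω × Ω → ℝ}

theorem abs_posetDefect_sub_le (hV : IsUnitFunction V) (hW : IsUnitFunction W) :
    |posetDefect μ V - posetDefect μ W| ≤ 6 * cutNorm μ (V - W) := by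
  have htrans := abs_triangleDensity_sub_le (μ := μ) hV hW hV hW
    (hV.one_sub.comp measurable_swap) (hW.one_sub.comp measurable_swap)
  have hcycle := abs_triangleDensity_sub_le (μ := μ) hV hW hV hW hV hW
  have hswap : cutNorm μ ((1 - V) ∘ Prod.swap - (1 - W) ∘ Prod.swap) = cutNorm μ (V - W) := by
    rw [← Pi.sub_comp, sub_sub_sub_cancel_left, cutNorm_comp_swap, cutNorm_sub_comm]
  rw [hswap] at htrans
  rw [posetDefect, posetDefect, add_sub_add_comm]
  linarith [abs_add_le
    (triangleDensity μ V V ((1 - V) ∘ Prod.swap) - triangleDensity μ W W ((1 - W) ∘ Prod.swap))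
    (triangleDensity μ V V V - triangleDensity μ W W W)]

theorem posetDefect_eq_zero_iff (hW : IsUnitFunction W) :
    posetDefect μ W = 0 ↔ ∀ᵐ t ∂(μ.prod (μ.prod μ)), 0 < W (t.1, t.2.1) → 0 < W t.2 →
      W (t.1, t.2.2) = 1 ∧ W (t.2.2, t.1) = 0 := by
  have hW' := hW.one_sub.comp measurable_swap
  rw [posetDefect, add_eq_zero_iff_of_nonneg (triangleDensity_nonneg μ hW hW hW')
    (triangleDensity_nonneg μ hW hW hW), triangleDensity_eq_zero_iff hW hW hW',
    triangleDensity_eq_zero_iff hW hW hW, EventuallyEq, EventuallyEq, ← eventually_and]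
  refine eventually_congr (.of_forall fun t => ?_)
  have hpos (p : Ω × Ω) : 0 < W p ↔ W p ≠ 0 := (hW.nonneg p).lt_iff_ne'
  simp only [triangleWeight, Pi.zero_apply, mul_eq_zero, hpos, Function.comp_apply, Prod.swap,
    Pi.sub_apply, Pi.one_apply, sub_eq_zero, eq_comm (a := (1 : ℝ))]
  tauto

end PosetDefect

namespace CutFunction

theorem abs_posetDefect_sub_le_cutDist (K₁ K₂ : CutFunction.{u}) :
    |posetDefect K₁.μ K₁.W - posetDefect K₂.μ K₂.W| ≤ 6 * cutDist K₁ K₂ := by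
  suffices |posetDefect K₁.μ K₁.W - posetDefect K₂.μ K₂.W| / 6 ≤ cutDist K₁ K₂ by linarith
  refine le_of_forall_gt_imp_ge_of_dense fun c hc => ?_
  obtain ⟨Ω, _, μ, _, φ₁, φ₂, h₁, h₂, h⟩ := exists_cutNorm_lt hc
  have hdefect := abs_posetDefect_sub_le (μ := μ)
    (K₁.isUnitFunction.comp (h₁.measurable.prodMap h₁.measurable))
    (K₂.isUnitFunction.comp (h₂.measurable.prodMap h₂.measurable))
  rw [posetDefect_comp h₁ K₁.isUnitFunction, posetDefect_comp h₂ K₂.isUnitFunction] at hdefect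
  linarith

theorem IsPosetKernel.posetDefect_eq_zero {K : CutFunction.{u}} (hK : K.IsPosetKernel) :
    posetDefect K.μ K.W = 0 := by
  obtain ⟨r, hr, -, hpos, htrans⟩ := hK
  refine (posetDefect_eq_zero_iff K.isUnitFunction).2 (.of_forall fun t hxy hyz =>
    ⟨htrans _ _ _ hxy hyz, (K.isUnitFunction.nonneg _).eq_of_not_lt' fun hzx => ?_⟩)
  exact hr.irrefl _ (hr.trans _ _ _ (hr.trans _ _ _ (hpos _ _ hxy) (hpos _ _ hyz)) (hpos _ _ hzx))

end CutFunction

section CondAveraging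

open scoped symmDiff

variable {Z ι : Type*} [MeasurableSpace Z] {A : Set Z}

theorem integral_abs_indicator_sub_measureReal {ν : Measure Z} [IsProbabilityMeasure ν]
    (hA : MeasurableSet A) :
    ∫ z, |A.indicator 1 z - ν.real A| ∂ν = 2 * (ν.real A * ν.real Aᶜ) := by
  have hcompl : ν.real Aᶜ = 1 - ν.real A := probReal_compl_eq_one_sub hA
  calc ∫ z, |A.indicator 1 z - ν.real A| ∂ν
      = ∫ z, (A.indicator (fun _ => ν.real Aᶜ) z + Aᶜ.indicator (fun _ => ν.real A) z) ∂ν := by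
        congr 1 with z
        by_cases hz : z ∈ A
        · simp [hz, ← hcompl]
        · simp [hz]
    _ = 2 * (ν.real A * ν.real Aᶜ) := by
        rw [integral_add ((integrable_const _).indicator hA)
          ((integrable_const _).indicator hA.compl), integral_indicator_const _ hA,
          integral_indicator_const _ hA.compl, smul_eq_mul, smul_eq_mul]
        ring

theorem integral_abs_indicator_sub_measureReal_le {ν : Measure Z} [IsZeroOrProbabilityMeasure ν]
    (hA : MeasurableSet A) {E : Set Z} (hE : E =ᵐ[ν] univ ∨ E =ᵐ[ν] (∅ : Set Z)) :
    ∫ z, |A.indicator 1 z - ν.real A| ∂ν ≤ 2 * ν.real (A ∆ E) := by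
  rcases eq_zero_or_isProbabilityMeasure ν with rfl | _
  · simp
  rw [integral_abs_indicator_sub_measureReal hA]
  gcongr
  rcases hE with hE | hE
  · rw [measureReal_congr (ae_eq_rfl.symmDiff hE), ← top_eq_univ, symmDiff_top]
    exact mul_le_of_le_one_left measureReal_nonneg measureReal_le_one
  · rw [measureReal_congr (ae_eq_rfl.symmDiff hE), ← bot_eq_empty, symmDiff_bot]
    exact mul_le_of_le_one_right measureReal_nonneg measureReal_le_one

variable [MeasurableSpace ι] [DiscreteMeasurableSpace ι] {μ : Measure Z}
  [IsFiniteMeasure μ] {g : Z → ι}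

theorem integral_eq_sum_mul_integral_cond_fiber [Fintype ι] (hg : Measurable g) {F : Z → ℝ}
    (hF : Integrable F μ) :
    ∫ z, F z ∂μ = ∑ i, μ.real (g ⁻¹' {i}) * ∫ z, F z ∂(μ[|g ← i]) := by
  conv_lhs => rw [← sum_meas_smul_cond_fiber hg μ]
  rw [integral_finsetSum_measure]
  · simp only [integral_smul_measure, measureReal_def, smul_eq_mul]
  · intro i _
    refine (hF.mono_measure ?_)
    conv_rhs => rw [← sum_meas_smul_cond_fiber hg μ]
    exact Finset.single_le_sum (f := fun i => μ (g ⁻¹' {i}) • μ[|g ← i])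
      (fun _ _ => Measure.zero_le _) (Finset.mem_univ i)

theorem integral_abs_indicator_sub_cond_le [Finite ι] (hg : Measurable g)
    (hA : MeasurableSet A) (S : Set ι) :
    ∫ z, |A.indicator 1 z - (μ[|g ← g z]).real A| ∂μ ≤ 2 * μ.real (A ∆ (g ⁻¹' S)) := by
  have := Fintype.ofFinite ι
  have hS : MeasurableSet (A ∆ (g ⁻¹' S)) := hA.symmDiff (hg .of_discrete)
  have hind {D : Set Z} (hD : MeasurableSet D) : Integrable (D.indicator (1 : Z → ℝ)) μ :=
    (integrable_const 1).indicator hD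
  have hcond : IsUnitFunction fun z => (μ[|g ← g z]).real A :=
    ⟨(Measurable.of_discrete (f := fun i => (μ[|g ← i]).real A)).comp hg,
      fun _ => ⟨measureReal_nonneg, measureReal_le_one⟩⟩
  rw [integral_eq_sum_mul_integral_cond_fiber hg
      (by exact ((hind hA).sub (hcond.integrable μ)).abs), ← integral_indicator_one hS,
    integral_eq_sum_mul_integral_cond_fiber hg (hind hS),
    Finset.mul_sum]
  refine Finset.sum_le_sum fun i _ => ?_
  have hgi : ∀ᵐ z ∂(μ[|g ← i]), g z = i := ae_cond_mem (hg (measurableSet_singleton i))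
  have hconst : ∫ z, |A.indicator 1 z - (μ[|g ← g z]).real A| ∂(μ[|g ← i]) =
      ∫ z, |A.indicator 1 z - (μ[|g ← i]).real A| ∂(μ[|g ← i]) :=
    integral_congr_ae (hgi.mono fun z hz => by simp only [hz])
  have hE : g ⁻¹' S =ᵐ[μ[|g ← i]] univ ∨ g ⁻¹' S =ᵐ[μ[|g ← i]] (∅ : Set Z) := by
    rw [eventuallyEq_univ, eventuallyEq_empty]
    by_cases hiS : i ∈ S
    · exact .inl (hgi.mono fun z hz => mem_preimage.2 (hz ▸ hiS))
    · exact .inr (hgi.mono fun z hz => mt mem_preimage.1 (hz ▸ hiS))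
  rw [hconst, integral_indicator_one hS, mul_left_comm]
  gcongr
  exact integral_abs_indicator_sub_measureReal_le hA hE

theorem ae_tendsto_of_summable_integral_abs {P : Measure Z} {G : Z → ℝ} {d : ℕ → Z → ℝ}
    (hG : Integrable G P) (hd : ∀ n, Integrable (d n) P)
    (h : Summable fun n => ∫ z, |G z - d n z| ∂P) :
    ∀ᵐ z ∂P, Tendsto (fun n => d n z) atTop (𝓝 (G z)) := by
  have hi (n : ℕ) : Integrable (G - d n) P := hG.sub (hd n)
  have hmeas (n : ℕ) : AEMeasurable (fun z => ‖(G - d n) z‖ₑ) P :=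
    (hi n).aestronglyMeasurable.enorm
  have hfin : ∫⁻ z, ∑' n, ‖(G - d n) z‖ₑ ∂P ≠ ⊤ := by
    rw [lintegral_tsum hmeas]
    simp only [← ofReal_integral_norm_eq_lintegral_enorm (hi _)]
    exact h.tsum_ofReal_ne_top
  filter_upwards [ae_lt_top' (AEMeasurable.tsum hmeas) hfin] with z hz
  have hzero := (ENNReal.tendsto_toReal ENNReal.zero_ne_top).comp
    (ENNReal.tendsto_atTop_zero_of_tsum_ne_top hz.ne)
  rw [tendsto_iff_norm_sub_tendsto_zero]
  refine hzero.congr fun n => ?_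
  simp [norm_sub_rev]

end CondAveraging

section CellDensity

open scoped symmDiff

variable {Ω ι : Type*} [MeasurableSpace Ω]

instance isZeroOrProbabilityMeasure_prod (μ ν : Measure Ω) [IsZeroOrProbabilityMeasure μ]
    [IsZeroOrProbabilityMeasure ν] : IsZeroOrProbabilityMeasure (μ.prod ν) := by
  rcases eq_zero_or_isProbabilityMeasure μ with rfl | _
  · rw [Measure.zero_prod]
    infer_instance
  rcases eq_zero_or_isProbabilityMeasure ν with rfl | _
  · rw [Measure.prod_zero]
    infer_instance
  infer_instance

/-- The density of `A` in the box containing `p` of the partition of the square into the products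
of the fibres of `f`; it is `0` on null boxes. -/
noncomputable def cellDensity (μ : Measure Ω) (f : Ω → ι) (A : Set (Ω × Ω)) (p : Ω × Ω) : ℝ :=
  ((μ[|f ← f p.1]).prod (μ[|f ← f p.2])).real A

theorem cond_prod {μ ν : Measure Ω} [IsFiniteMeasure μ] [IsFiniteMeasure ν] (S T : Set Ω) :
    (μ.prod ν)[|S ×ˢ T] = (μ[|S]).prod (ν[|T]) := by
  simp only [ProbabilityTheory.cond]
  rw [Measure.prod_smul_left, Measure.prod_smul_right, smul_smul,
    Measure.prod_restrict, Measure.prod_prod, ENNReal.mul_inv (.inr (measure_ne_top _ _))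
    (.inl (measure_ne_top _ _))]

theorem cellDensity_eq_cond (μ : Measure Ω) [IsFiniteMeasure μ] (f : Ω → ι) (A : Set (Ω × Ω))
    (p : Ω × Ω) :
    cellDensity μ f A p = ((μ.prod μ)[|Prod.map f f ← Prod.map f f p]).real A := by
  rw [cellDensity, ← cond_prod, ← preimage_prod_map_prod, singleton_prod_singleton]
  rfl

theorem cellDensity_le_one (μ : Measure Ω) (f : Ω → ι) (A : Set (Ω × Ω)) (p : Ω × Ω) :
    cellDensity μ f A p ≤ 1 := measureReal_le_one

theorem cellDensity_mono {μ : Measure Ω} {f : Ω → ι} {A B : Set (Ω × Ω)} (h : A ⊆ B)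
    (p : Ω × Ω) : cellDensity μ f A p ≤ cellDensity μ f B p := measureReal_mono h

theorem measureReal_add_sub_one_le_of_ae_imp {Z : Type*} [MeasurableSpace Z] {P : Measure Z}
    [IsProbabilityMeasure P] {C D E : Set Z} (hD : MeasurableSet D)
    (h : ∀ᵐ z ∂P, z ∈ C → z ∈ D → z ∈ E) : P.real C + P.real D - 1 ≤ P.real E := by
  have hCD : P.real (C ∩ D) ≤ P.real E :=
    ENNReal.toReal_mono (measure_ne_top _ _) (measure_mono_ae (h.mono fun z hz hCD =>
      hz hCD.1 hCD.2))
  linarith [measureReal_union_add_inter (μ := P) (s := C) hD,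
    measureReal_le_one (μ := P) (s := C ∪ D)]

theorem measureReal_prod_add_sub_one_le_of_ae_trans {ν₁ ν₂ ν₃ : Measure Ω}
    [IsZeroOrProbabilityMeasure ν₁] [IsZeroOrProbabilityMeasure ν₂]
    [IsZeroOrProbabilityMeasure ν₃] {A B : Set (Ω × Ω)} (hA : MeasurableSet A)
    (hB : MeasurableSet B)
    (h : ∀ᵐ t ∂(ν₁.prod (ν₂.prod ν₃)), (t.1, t.2.1) ∈ A → t.2 ∈ A → (t.1, t.2.2) ∈ B) :
    (ν₁.prod ν₂).real A + (ν₂.prod ν₃).real A - 1 ≤ (ν₁.prod ν₃).real B := by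
  rcases eq_zero_or_isProbabilityMeasure ν₁ with rfl | _
  · simp
  rcases eq_zero_or_isProbabilityMeasure ν₂ with rfl | _
  · simpa using neg_one_lt_zero.le.trans measureReal_nonneg
  rcases eq_zero_or_isProbabilityMeasure ν₃ with rfl | _
  · simp
  have h₁₂ : MeasurePreserving (Prod.map id Prod.fst) (ν₁.prod (ν₂.prod ν₃)) (ν₁.prod ν₂) :=
    (MeasurePreserving.id ν₁).prod measurePreserving_fst
  have h₁₃ : MeasurePreserving (Prod.map id Prod.snd) (ν₁.prod (ν₂.prod ν₃)) (ν₁.prod ν₃) :=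
    (MeasurePreserving.id ν₁).prod measurePreserving_snd
  have h₂₃ : MeasurePreserving Prod.snd (ν₁.prod (ν₂.prod ν₃)) (ν₂.prod ν₃) :=
    measurePreserving_snd
  rw [← h₁₂.measureReal_preimage hA.nullMeasurableSet,
    ← h₂₃.measureReal_preimage hA.nullMeasurableSet,
    ← h₁₃.measureReal_preimage hB.nullMeasurableSet]
  exact measureReal_add_sub_one_le_of_ae_imp (h₂₃.measurable hA) h

variable {μ : Measure Ω} {A B : Set (Ω × Ω)}

theorem cellDensity_add_sub_one_le (f : Ω → ι) (hA : MeasurableSet A) (hB : MeasurableSet B)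
    [SFinite μ]
    (h : ∀ᵐ t ∂(μ.prod (μ.prod μ)), (t.1, t.2.1) ∈ A → t.2 ∈ A → (t.1, t.2.2) ∈ B) (x y z : Ω) :
    cellDensity μ f A (x, y) + cellDensity μ f A (y, z) - 1 ≤ cellDensity μ f B (x, z) := by
  have hac (x : Ω) : μ[|f ← f x] ≪ μ := cond_absolutelyContinuous
  exact measureReal_prod_add_sub_one_le_of_ae_trans hA hB
    (((hac x).prod ((hac y).prod (hac z))).ae_le h)

/-- The transitivity inequality at `x = y = z`, with the non-reversed pairs as target. -/
theorem cellDensity_diag_le (f : Ω → ι) (hA : MeasurableSet A) [SFinite μ]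
    (h : ∀ᵐ t ∂(μ.prod (μ.prod μ)), (t.1, t.2.1) ∈ A → t.2 ∈ A → (t.2.2, t.1) ∉ A) (x : Ω) :
    cellDensity μ f A (x, x) ≤ 2 / 3 := by
  rcases eq_zero_or_isProbabilityMeasure (μ[|f ← f x]) with hν | _
  · have hzero : cellDensity μ f A (x, x) = 0 := by simp [cellDensity, hν]
    linarith
  have htrans := cellDensity_add_sub_one_le f hA (measurable_swap hA).compl h x x x
  simp only [cellDensity] at htrans ⊢
  rw [probReal_compl_eq_one_sub (measurable_swap hA),
    Measure.measurePreserving_swap.measureReal_preimage hA.nullMeasurableSet] at htrans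
  linarith

section Approximation

variable [MeasurableSpace ι] [DiscreteMeasurableSpace ι] {f : Ω → ι}

theorem isUnitFunction_cellDensity [Countable ι] (hf : Measurable f) :
    IsUnitFunction (cellDensity μ f A) := by
  have hd : Measurable fun q : ι × ι => ((μ[|f ← q.1]).prod (μ[|f ← q.2])).real A := .of_discrete
  have hcell := hd.comp (hf.prodMap hf)
  exact ⟨hcell, fun p => ⟨measureReal_nonneg, cellDensity_le_one μ f A p⟩⟩

theorem integral_abs_indicator_sub_cellDensity_le [IsFiniteMeasure μ] [Finite ι]
    (hf : Measurable f) (hA : MeasurableSet A) (S : Set (ι × ι)) :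
    ∫ p, |A.indicator 1 p - cellDensity μ f A p| ∂(μ.prod μ) ≤
      2 * (μ.prod μ).real (A ∆ (Prod.map f f ⁻¹' S)) := by
  have hfg : Measurable (Prod.map f f) := hf.prodMap hf
  simp only [cellDensity_eq_cond]
  exact integral_abs_indicator_sub_cond_le hfg hA S

end Approximation

end CellDensity

section DensityPoints

open scoped symmDiff

variable {Ω : Type*} [MeasurableSpace Ω] {μ : Measure Ω} {A B : Set (Ω × Ω)} {m : ℕ → ℕ}
  {f : ∀ n, Ω → Fin (m n)}

/-- The points at which `A` has density `1` along the partitions of the square into the products of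
the fibres of `f n`. -/
def densityPoints (μ : Measure Ω) (f : ∀ n, Ω → Fin (m n)) (A : Set (Ω × Ω)) : Set (Ω × Ω) :=
  {p | Tendsto (fun n => cellDensity μ (f n) A p) atTop (𝓝 1)}

theorem measurableSet_densityPoints (hf : ∀ n, Measurable (f n)) :
    MeasurableSet (densityPoints μ f A) :=
  measurableSet_tendsto (𝓝 1) fun n => (isUnitFunction_cellDensity (hf n)).measurable

theorem densityPoints_mono (h : A ⊆ B) : densityPoints μ f A ⊆ densityPoints μ f B :=
  fun p hp => tendsto_of_tendsto_of_tendsto_of_le_of_le hp tendsto_const_nhds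
    (fun _ => cellDensity_mono h p) fun n => cellDensity_le_one μ (f n) B p

theorem densityPoints_trans [SFinite μ] (hA : MeasurableSet A) (hB : MeasurableSet B)
    (h : ∀ᵐ t ∂(μ.prod (μ.prod μ)), (t.1, t.2.1) ∈ A → t.2 ∈ A → (t.1, t.2.2) ∈ B) {x y z : Ω}
    (hxy : (x, y) ∈ densityPoints μ f A) (hyz : (y, z) ∈ densityPoints μ f A) :
    (x, z) ∈ densityPoints μ f B := by
  have hsum : Tendsto (fun n => cellDensity μ (f n) A (x, y) + cellDensity μ (f n) A (y, z) - 1)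
      atTop (𝓝 1) := by
    simpa using (Tendsto.add hxy hyz).sub_const 1
  exact tendsto_of_tendsto_of_tendsto_of_le_of_le hsum tendsto_const_nhds
    (fun n => cellDensity_add_sub_one_le (f n) hA hB h x y z)
    fun n => cellDensity_le_one μ (f n) B _

theorem diag_notMem_densityPoints [SFinite μ] (hA : MeasurableSet A)
    (h : ∀ᵐ t ∂(μ.prod (μ.prod μ)), (t.1, t.2.1) ∈ A → t.2 ∈ A → (t.2.2, t.1) ∉ A) (x : Ω) :
    (x, x) ∉ densityPoints μ f A := fun hx => by
  have hle : (1 : ℝ) ≤ 2 / 3 := le_of_tendsto' hx fun n => cellDensity_diag_le (f n) hA h x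
  norm_num at hle

variable [IsFiniteMeasure μ]

theorem densityPoints_ae_eq (hf : ∀ n, Measurable (f n)) (hA : MeasurableSet A)
    (S : ∀ n, Set (Fin (m n) × Fin (m n)))
    (hS : Summable fun n => (μ.prod μ).real (A ∆ (Prod.map (f n) (f n) ⁻¹' S n))) :
    densityPoints μ f A =ᵐ[μ.prod μ] A := by
  have hsum : Summable fun n => ∫ p, |A.indicator 1 p - cellDensity μ (f n) A p| ∂(μ.prod μ) :=
    .of_nonneg_of_le (fun n => integral_nonneg fun p => abs_nonneg _)
      (fun n => integral_abs_indicator_sub_cellDensity_le (hf n) hA (S n)) (hS.mul_left 2)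
  refine eventuallyEq_set.2 ((ae_tendsto_of_summable_integral_abs
    ((integrable_const (1 : ℝ)).indicator hA)
    (fun n => (isUnitFunction_cellDensity (hf n)).integrable _) hsum).mono fun p hp => ?_)
  by_cases hpA : p ∈ A
  · simpa [densityPoints, hpA] using hp
  · rw [indicator_of_notMem hpA] at hp
    exact iff_of_false (fun h => zero_ne_one (tendsto_nhds_unique hp h)) hpA

theorem exists_isStep_measureReal_symmDiff_lt (hA : MeasurableSet A) {ε : ℝ} (hε : 0 < ε) :
    ∃ n, ∃ E : Set (Ω × Ω), IsStep n (· ∈ E) ∧ (μ.prod μ).real (A ∆ E) < ε := by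
  obtain ⟨E, ⟨n, hE⟩, hAE⟩ :=
    (measureDense_isStep (μ.prod μ)).approx A hA (measure_ne_top _ _) ε hε
  exact ⟨n, E, hE, (ENNReal.lt_ofReal_iff_toReal_lt (measure_ne_top _ _)).1 hAE⟩

theorem exists_measureReal_symmDiff_preimage_lt (hA : MeasurableSet A) (hB : MeasurableSet B)
    {ε : ℝ} (hε : 0 < ε) :
    ∃ (n : ℕ) (f : Ω → Fin n) (S T : Set (Fin n × Fin n)), Measurable f ∧
      (μ.prod μ).real (A ∆ (Prod.map f f ⁻¹' S)) < ε ∧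
      (μ.prod μ).real (B ∆ (Prod.map f f ⁻¹' T)) < ε := by
  obtain ⟨n, E, hE, hAE⟩ := exists_isStep_measureReal_symmDiff_lt (μ := μ) hA hε
  obtain ⟨m, F, hF, hBF⟩ := exists_isStep_measureReal_symmDiff_lt (μ := μ) hB hε
  obtain ⟨f, hf, U, hU⟩ := hE.map₂ hF Prod.mk
  have hES : E = Prod.map f f ⁻¹' {q | (U q).1} := by
    ext p
    exact iff_of_eq (congrArg Prod.fst (congrFun hU p))
  have hFT : F = Prod.map f f ⁻¹' {q | (U q).2} := by
    ext p
    exact iff_of_eq (congrArg Prod.snd (congrFun hU p))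
  exact ⟨_, f, {q | (U q).1}, {q | (U q).2}, hf, hES ▸ hAE, hFT ▸ hBF⟩

theorem exists_densityPoints_ae_eq (hA : MeasurableSet A) (hB : MeasurableSet B) :
    ∃ (m : ℕ → ℕ) (f : ∀ n, Ω → Fin (m n)), (∀ n, Measurable (f n)) ∧
      densityPoints μ f A =ᵐ[μ.prod μ] A ∧ densityPoints μ f B =ᵐ[μ.prod μ] B := by
  choose m f S T hf hS hT using fun k : ℕ =>
    exists_measureReal_symmDiff_preimage_lt (μ := μ) hA hB (pow_pos (one_half_pos (α := ℝ)) k)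
  have hsum {r : ℕ → ℝ} (hr : ∀ k, 0 ≤ r k) (hlt : ∀ k, r k < (1 / 2) ^ k) : Summable r :=
    .of_nonneg_of_le hr (fun k => (hlt k).le) summable_geometric_two
  exact ⟨m, f, hf, densityPoints_ae_eq hf hA S (hsum (fun _ => measureReal_nonneg) hS),
    densityPoints_ae_eq hf hB T (hsum (fun _ => measureReal_nonneg) hT)⟩

end DensityPoints

namespace CutFunction

theorem cutEquiv_of_ae_eq (K : CutFunction.{u}) {V : K.carrier × K.carrier → ℝ}
    (hV : IsUnitFunction V) (h : K.W =ᵐ[K.μ.prod K.μ] V) :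
    K.CutEquiv ⟨K.carrier, K.μ, V, hV.measurable, hV.mem_Icc⟩ := by
  let L : CutFunction.{u} := ⟨K.carrier, K.μ, V, hV.measurable, hV.mem_Icc⟩
  have hid : MeasurePreserving id K.μ K.μ := .id K.μ
  have hzero : K.W - V =ᵐ[K.μ.prod K.μ] 0 := h.mono fun p hp => sub_eq_zero.2 hp
  have hnorm : cutNorm K.μ (K.W - V) ≤ 0 := by
    rw [cutNorm_congr_ae hzero]
    simp [cutNorm_le]
  exact le_antisymm ((cutDist_le (K₂ := L) hid hid).trans hnorm) (cutDist_nonneg K L)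

theorem exists_isPosetKernel_cutEquiv_of_ae_eq (K : CutFunction.{u})
    {R S : Set (K.carrier × K.carrier)} (hR : MeasurableSet R) (hS : MeasurableSet S)
    (hSR : S ⊆ R) (hirrefl : ∀ x, (x, x) ∉ R)
    (htrans : ∀ {x y z}, (x, y) ∈ R → (y, z) ∈ R → (x, z) ∈ S)
    (hRW : R =ᵐ[K.μ.prod K.μ] {p | 0 < K.W p}) (hSW : S =ᵐ[K.μ.prod K.μ] {p | K.W p = 1}) :
    ∃ K' : CutFunction.{u}, K'.IsPosetKernel ∧ K.CutEquiv K' := by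
  classical
  let V : K.carrier × K.carrier → ℝ := S.piecewise 1 (R.indicator K.W)
  have hVR {p} (hp : 0 < V p) : p ∈ R := by
    by_contra hpR
    simp [V, hpR, mt (@hSR p) hpR] at hp
  have hV : IsUnitFunction V := by
    refine ⟨measurable_one.piecewise hS (K.measurable_W.indicator hR), fun p => ?_⟩
    simp only [V, piecewise, indicator]
    split_ifs
    exacts [right_mem_Icc.2 zero_le_one, K.W_mem p, left_mem_Icc.2 zero_le_one]
  have hWV : K.W =ᵐ[K.μ.prod K.μ] V := by
    filter_upwards [eventuallyEq_set.1 hRW, eventuallyEq_set.1 hSW] with p hpR hpS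
    by_cases h₁ : p ∈ S
    · simpa [V, h₁] using hpS.1 h₁
    by_cases h₀ : p ∈ R
    · simp [V, h₁, h₀]
    · simpa [V, h₁, h₀] using le_antisymm (not_lt.1 (mt hpR.2 h₀)) (K.W_mem p).1
  have hposet : IsPosetKernel ⟨K.carrier, K.μ, V, hV.measurable, hV.mem_Icc⟩ :=
    ⟨fun x y => (x, y) ∈ R,
      { irrefl := hirrefl, trans := fun x y z hxy hyz => hSR (htrans hxy hyz) }, hR,
      fun x y => hVR, fun x y z hxy hyz => piecewise_eq_of_mem _ _ _ (htrans (hVR hxy) (hVR hyz))⟩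
  exact ⟨_, hposet, K.cutEquiv_of_ae_eq hV hWV⟩

theorem exists_isPosetKernel_cutEquiv {K : CutFunction.{u}} (hK : posetDefect K.μ K.W = 0) :
    ∃ K' : CutFunction.{u}, K'.IsPosetKernel ∧ K.CutEquiv K' := by
  have hA : MeasurableSet {p | 0 < K.W p} := measurableSet_lt measurable_const K.measurable_W
  have hB : MeasurableSet {p | K.W p = 1} := K.measurable_W (measurableSet_singleton 1)
  have hBA : {p | K.W p = 1} ⊆ {p | 0 < K.W p} := fun p hp => one_pos.trans_eq hp.symm
  have hae := (posetDefect_eq_zero_iff K.isUnitFunction).1 hK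
  obtain ⟨m, f, hf, hRA, hSB⟩ := exists_densityPoints_ae_eq (μ := K.μ) hA hB
  exact K.exists_isPosetKernel_cutEquiv_of_ae_eq (measurableSet_densityPoints hf)
    (measurableSet_densityPoints hf) (densityPoints_mono hBA)
    (diag_notMem_densityPoints hA (hae.mono fun t ht hxy hyz => (ht hxy hyz).2.not_gt))
    (densityPoints_trans hA hB (hae.mono fun t ht hxy hyz => (ht hxy hyz).1)) hRA hSB

end CutFunction

namespace CutSpace

theorem mk_mem_posetKernels_iff {K : CutFunction.{u}} :
    mk K ∈ posetKernels ↔ posetDefect K.μ K.W = 0 := by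
  refine ⟨fun ⟨L, hL, hLK⟩ => ?_, fun hK => ?_⟩
  · have hbound := CutFunction.abs_posetDefect_sub_le_cutDist L K
    rw [hL.posetDefect_eq_zero, mk_eq_mk.1 hLK, zero_sub, abs_neg, mul_zero] at hbound
    exact abs_nonpos_iff.1 hbound
  · obtain ⟨K', hK', hKK'⟩ := CutFunction.exists_isPosetKernel_cutEquiv hK
    exact ⟨K', hK', (mk_eq_mk.2 hKK').symm⟩

theorem isClosed_posetKernels : IsClosed posetKernels.{u} := by
  let defect (x : CutSpace.{u}) : ℝ := posetDefect (Quot.out x).μ (Quot.out x).W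
  have hdefect : LipschitzWith 6 defect := .of_dist_le_mul fun x y =>
    CutFunction.abs_posetDefect_sub_le_cutDist (Quot.out x) (Quot.out y)
  have hzero : posetKernels.{u} = defect ⁻¹' {0} := by
    ext x
    rw [← mk_out x, mk_mem_posetKernels_iff, mk_out]
    rfl
  exact hzero ▸ isClosed_singleton.preimage hdefect.continuous

end CutSpace

/-- Cut-equivalence is an equivalence relation, the cut metric is well defined on the quotient and
makes it a compact metric space, and the classes of poset kernels form a closed, hence compact,
subspace. -/
theorem theorem6p10 :
    Equivalence CutFunction.CutEquiv.{u} ∧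
    ∃ m : MetricSpace CutSpace.{u},
      (∀ K₁ K₂ : CutFunction.{u},
        dist (CutSpace.mk K₁) (CutSpace.mk K₂) = CutFunction.cutDist K₁ K₂) ∧
      CompactSpace CutSpace.{u} ∧
      IsClosed CutSpace.posetKernels.{u} ∧
      IsCompact CutSpace.posetKernels.{u} :=
  ⟨CutFunction.cutEquiv_equivalence, inferInstance, CutSpace.dist_mk_mk, inferInstance,
    CutSpace.isClosed_posetKernels, CutSpace.isClosed_posetKernels.isCompact⟩
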